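/- Let $\mathcal X$ be a finite or countably infinite alphabet of positive integers, let $p\ge 3$, let $\mathrm T$ be a tree with node set $\{1,\dots,p\}$, and let $\mathbf X=(X_1,\dots,X_p)$ be a random vector with values in $\mathcal X^p$ and probability mass function $\mathrm p$. Write $\mathrm p_i$ and $\mathrm p_{i,j}$ for its one- and two-dimensional marginals, and $$I(X_i;X_j)=\sum_{k,\ell\in\mathcal X}\mathrm p_{i,j}(k,\ell)\log_2\frac{\mathrm p_{i,j}(k,\ell)}{\mathrm p_i(k)\,\mathrm p_j(\ell)}.$$ For $c,c_1,c_2>0$, say that $\mathrm p\in\mathcal P_{\mathrm T}(c;c_1,c_2)$ if (a) $\mathrm p(\mathbf x)=\prod_{i}\mathrm p_i(x_i)\prod_{(i,j)\in\mathcal E_{\mathrm T}}\frac{\mathrm p_{i,j}(x_i,x_j)}{\mathrm p_i(x_i)\mathrm p_j(x_j)}$ for all $\mathbf x\in\mathcal X^p$, where each edge of $\mathrm T$ occurs once in the product; (b) $c_1/k^c\le \mathrm p_i(k)\le c_2/k^c$ for all $i$ and all $k\in\mathcal X$, and $c_1/(k\ell)^c\le \mathrm p_{i,j}(k,\ell)\le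 c_2/(k\ell)^c$ for all $i\ne j$ and all $k,\ell\in\mathcal X$; (c) $I(X_i;X_j)>0$ for all $i\neq j$, and $\mathrm p$ is not a point mass. The information threshold of $\mathrm p$ is $$\mathbf I^o=\frac12\min\bigl(I(X_w;X_{\bar w})-I(X_u;X_{\bar u})\bigr),$$ where the minimum is over all edges $(w,\bar w)$ of $\mathrm T$ and all nodes $u,\bar u$ such that the path of $\mathrm T$ from $u$ to $\bar u$ contains the edge $(w,\bar w)$ and has at least two edges. Given i.i.d. samples $\mathbf X^{1:n}$ of $\mathbf X$, the Chow-Liu algorithm computes the empirical marginals $\hat{\mathrm p}_i,\hat{\mathrm p}_{i,j}$ and the plug-in estimates $\hat I(X_i;X_j)=\sum_{k,\ell}\hat{\mathrm p}_{i,j}(k,\ell)\log_2\frac{\hat{\mathrm p}_{i,j}(k,\ell)}{\hat{\mathrm p}_i(k)\hat{\mathrm p}_j(\ell)}$, and returns a maximum-weight spanning tree $\mathrm T^{\mathrm{CL}}$ of the complete graph on $\{1,\dots,p\}$ with edge weights $\hat I(X_i;X_j)$, ties being broken arbitrarily. **Theorem.** Let $c\ge 2$ and $c_1,c_2>0$.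 There is a constant $C>0$, depending only on $c,c_1,c_2$, such that the following holds for all $\mathcal X$, $p\ge3$, $\mathrm T$ and $\mathrm p\in\mathcal P_{\mathrm T}(c;c_1,c_2)$ as above, all $\delta\in(0,1)$ and all $n\ge2$. If $$\frac{n}{\log_2^2 n}\ \ge\ \frac{72\log(p/\delta)}{\bigl(\mathbf I^o-C\frac{\log n}{\sqrt n}\bigr)^2}\qquad\text{and}\qquad \mathbf I^o> C\,\frac{\log n}{\sqrt n},$$ where $\log$ is the natural logarithm, then with probability at least $1-\delta$ the Chow-Liu algorithm with input $\mathbf X^{1:n}$ returns $\mathrm T^{\mathrm{CL}}=\mathrm T$, whichever way ties are broken. -/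

import Mathlib

namespace ChowLiu

noncomputable section

open scoped Classical

/-- Mutual information, in bits, of a joint mass function `q` with marginals `q₁` and `q₂`. -/
def mutualInfo {α : Type*} (q : α → α → ℝ) (q₁ q₂ : α → ℝ) : ℝ :=
  ∑' a : α × α, q a.1 a.2 * Real.logb 2 (q a.1 a.2 / (q₁ a.1 * q₂ a.2))

/-- The edges of a graph on `Fin p`, each one listed once as an ordered pair `(i, j)`, `i < j`. -/
def edgePairs {p : ℕ} (T : SimpleGraph (Fin p)) : Finset (Fin p × Fin p) :=
  Finset.univ.filter fun e => e.1 < e.2 ∧ T.Adj e.1 e.2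

section Law

variable {p : ℕ} {α : Type*}

/-- Mass function of the coordinate `X_i` of a random vector with law `P`. -/
def marginal (P : PMF (Fin p → α)) (i : Fin p) (k : α) : ℝ :=
  (P.map (fun x => x i) k).toReal

/-- Joint mass function of the pair `(X_i, X_j)`. -/
def pairMarginal (P : PMF (Fin p → α)) (i j : Fin p) (k l : α) : ℝ :=
  (P.map (fun x => (x i, x j)) (k, l)).toReal

/-- The mutual information `I(X_i; X_j)`. -/
def pairInfo (P : PMF (Fin p → α)) (i j : Fin p) : ℝ :=
  mutualInfo (pairMarginal P i j) (marginal P i) (marginal P j)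

/-- The law `P` factorizes over the edges of `T`. -/
def Factorizes (T : SimpleGraph (Fin p)) (P : PMF (Fin p → α)) : Prop :=
  ∀ x : Fin p → α, (P x).toReal =
    (∏ i, marginal P i (x i)) *
      ∏ e ∈ edgePairs T, pairMarginal P e.1 e.2 (x e.1) (x e.2) /
        (marginal P e.1 (x e.1) * marginal P e.2 (x e.2))

end Law

/-- The class of tree-structured laws on `𝒳 ^ p` (with `𝒳` a set of positive integers) that are
Markov on the tree `T`, with power-law one- and two-dimensional marginals, positive pairwise mutual
informations, and that are not a point mass. -/
structure TreeClass {p : ℕ} {𝒳 : Set ℕ} (T : SimpleGraph (Fin p)) (c c₁ c₂ : ℝ)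
    (P : PMF (Fin p → 𝒳)) : Prop where
  isTree : T.IsTree
  factorizes : Factorizes T P
  marginal_bounds : ∀ (i : Fin p) (k : 𝒳),
    c₁ / ((k : ℕ) : ℝ) ^ c ≤ marginal P i k ∧ marginal P i k ≤ c₂ / ((k : ℕ) : ℝ) ^ c
  pair_bounds : ∀ i j : Fin p, i ≠ j → ∀ k l : 𝒳,
    c₁ / (((k : ℕ) : ℝ) * ((l : ℕ) : ℝ)) ^ c ≤ pairMarginal P i j k l ∧
      pairMarginal P i j k l ≤ c₂ / (((k : ℕ) : ℝ) * ((l : ℕ) : ℝ)) ^ c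
  info_pos : ∀ i j : Fin p, i ≠ j → 0 < pairInfo P i j
  nondegenerate : ∀ x : Fin p → 𝒳, P x ≠ 1

/-- All tuples `((w, w'), (u, u'))` such that `(w, w')` is an edge of `T` on the path of `T` from
`u` to `u'`, and this path has at least two edges. -/
def feasibleSet {p : ℕ} (T : SimpleGraph (Fin p)) : Set ((Fin p × Fin p) × (Fin p × Fin p)) :=
  {τ | T.Adj τ.1.1 τ.1.2 ∧
    ∃ q : T.Walk τ.2.1 τ.2.2, q.IsPath ∧ s(τ.1.1, τ.1.2) ∈ q.edges ∧ 2 ≤ q.length}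

/-- The information threshold: half of the smallest gap `I(X_w; X_w') - I(X_u; X_u')` over the
(finite) feasible set. -/
def infoThreshold {p : ℕ} {α : Type*} (T : SimpleGraph (Fin p)) (P : PMF (Fin p → α)) : ℝ :=
  (1 / 2) * ⨅ τ : feasibleSet T,
    (pairInfo P τ.1.1.1 τ.1.1.2 - pairInfo P τ.1.2.1 τ.1.2.2)

section Algorithm

variable {p n : ℕ} {α : Type*}

/-- Empirical mass function of the coordinate `i` of the data `z 0, …, z (n - 1)`. -/
def empMarginal (z : Fin n → Fin p → α) (i : Fin p) (k : α) : ℝ :=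
  ((Finset.univ.filter fun t : Fin n => z t i = k).card : ℝ) / n

/-- Empirical joint mass function of the coordinates `i` and `j`. -/
def empPairMarginal (z : Fin n → Fin p → α) (i j : Fin p) (k l : α) : ℝ :=
  ((Finset.univ.filter fun t : Fin n => z t i = k ∧ z t j = l).card : ℝ) / n

/-- The plug-in estimate of the mutual information. -/
def empPairInfo (z : Fin n → Fin p → α) (i j : Fin p) : ℝ :=
  mutualInfo (empPairMarginal z i j) (empMarginal z i) (empMarginal z j)

/-- Total weight of a graph with respect to the (symmetric) edge weights `w`. -/
def totalWeight (w : Fin p → Fin p → ℝ) (T : SimpleGraph (Fin p)) : ℝ :=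
  ∑ e ∈ edgePairs T, w e.1 e.2

/-- `T` is a maximum-weight spanning tree of the complete graph on `Fin p`. -/
def IsMaxSpanningTree (w : Fin p → Fin p → ℝ) (T : SimpleGraph (Fin p)) : Prop :=
  T.IsTree ∧ ∀ T' : SimpleGraph (Fin p), T'.IsTree → totalWeight w T' ≤ totalWeight w T

/-- The set of all trees that the Chow-Liu algorithm may return on the data `z`, over all ways of
breaking ties in the maximum spanning tree step. -/
def chowLiuOutputs (z : Fin n → Fin p → α) : Set (SimpleGraph (Fin p)) :=
  {T | IsMaxSpanningTree (empPairInfo z) T}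

end Algorithm

end

end ChowLiu

/-! Suppose that every estimate is within `I°` of the true information. The true gap between a
`T`-edge on a `T`-path of length at least two and the pair of end points of the path is at least `2
I°`, so the edge is still strictly heavier empirically. An exchange argument then makes `T` the
unique maximum-weight spanning tree (`isMaxSpanningTree_iff_eq`, `chowLiuOutputs_eq`). It remains to
estimate all pairwise informations uniformly, and the error splits into fluctuation and bias.

Fluctuation: in nats, the plug-in information is `log n` plus a signed combination of three sums of
`m log m` over the counts `m`, divided by `n`. Replacing one sample point moves each sum by at most
`log n + 1`, whatever the alphabet, so McDiarmid's inequality gives an exponential tail, and a union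
bound covers the at most `p² / 2` pairs.

Bias: in nats, the plug-in information is an unbiased sample mean of the log-likelihood ratio, plus
the divergence of the joint empirical law from the true one, minus the same divergences for the two
marginals (`empPairInfo_mul_log_two_eq`). Each divergence is nonnegative with mean at most `∑ q log
(1 + 1 / (n q))` (`integral_empDiv_le`). The summand is monotone in `q`, so the power-law bounds
with `c ≥ 2` reduce everything to masses of order `(k l)⁻²`, for which the series is `O(log n /
√n)`; the logarithm is a harmonic sum over `k ≤ n`. The constant `C` comes from this bias alone, and
`I° - C log n / √n` is the deviation left to McDiarmid's inequality. -/

open MeasureTheory ProbabilityTheory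

namespace ChowLiu

/-! ### McDiarmid's inequality -/

/-- A function of `n` variables that changes by at most `c` when one variable changes stays within
`n * c` of each of its values. -/
theorem abs_sub_le_of_boundedDifferences {S : Type*} {n : ℕ} {F : (Fin n → S) → ℝ} {c : ℝ}
    (hF : ∀ x t s, |F (Function.update x t s) - F x| ≤ c) (x y : Fin n → S) :
    |F x - F y| ≤ n * c := by
  induction n with
  | zero => simp [Subsingleton.elim x y]
  | succ n ih =>
    have h1 : |F x - F (Fin.cons (y 0) (Fin.tail x))| ≤ c := by
      rw [abs_sub_comm, ← Fin.update_cons_zero (x 0), Fin.cons_self_tail]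
      exact hF _ _ _
    have h2 := ih (F := fun z => F (Fin.cons (y 0) z)) (fun z t s => by
      rw [Fin.cons_update]; exact hF _ _ _) (Fin.tail x) (Fin.tail y)
    simp only [Fin.cons_self_tail] at h2
    have := abs_sub_le (F x) (F (Fin.cons (y 0) (Fin.tail x))) (F y)
    push_cast
    linarith

theorem memIcc_of_boundedDifferences {S : Type*} {n : ℕ} {F : (Fin n → S) → ℝ} {c : ℝ}
    (hF : ∀ x t s, |F (Function.update x t s) - F x| ≤ c) :
    ∃ a b, ∀ x, F x ∈ Set.Icc a b := by
  rcases isEmpty_or_nonempty (Fin n → S) with h | ⟨⟨y⟩⟩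
  · exact ⟨0, 0, fun x => h.elim x⟩
  · refine ⟨F y - n * c, F y + n * c, fun x => ?_⟩
    have := abs_le.1 (abs_sub_le_of_boundedDifferences hF x y)
    constructor <;> linarith

/-- **McDiarmid's inequality**, in its moment generating function form. -/
theorem mgf_le_of_boundedDifferences {S : Type*} [MeasurableSpace S] (ν : Measure S)
    [IsProbabilityMeasure ν] {n : ℕ} {F : (Fin n → S) → ℝ} (hm : Measurable F) {c : ℝ}
    (hF : ∀ x t s, |F (Function.update x t s) - F x| ≤ c) (l : ℝ) :
    ∫ x, Real.exp (l * (F x - ∫ y, F y ∂Measure.pi fun _ : Fin n => ν))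
      ∂Measure.pi (fun _ : Fin n => ν) ≤ Real.exp (n * (c ^ 2 / 8) * l ^ 2) := by
  induction n with
  | zero =>
    have : F = fun _ => F default := funext fun x => by rw [Subsingleton.elim x default]
    rw [this]; simp
  | succ n ih =>
    obtain ⟨a, b, hab⟩ := memIcc_of_boundedDifferences hF
    have hsymm : ∀ (s : S) (y : Fin n → S),
        (MeasurableEquiv.piFinSuccAbove (fun _ : Fin (n + 1) => S) 0).symm (s, y) =
          Fin.cons s y := fun s y => by
      rw [← Fin.insertNth_zero']; rfl
    have key : ∀ H : (Fin (n + 1) → S) → ℝ, Measurable H → (∃ a b, ∀ x, H x ∈ Set.Icc a b) →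
        ∫ x, H x ∂Measure.pi (fun _ : Fin (n + 1) => ν) =
          ∫ s, ∫ y, H (Fin.cons s y) ∂Measure.pi (fun _ : Fin n => ν) ∂ν := by
      intro H hH ⟨a, b, h⟩
      have mp := measurePreserving_piFinSuccAbove (fun _ : Fin (n + 1) => ν) 0
      rw [← (mp.symm).integral_comp' (g := H), integral_prod]
      · simp only [hsymm]
      · exact Integrable.of_mem_Icc a b
          (hH.comp (MeasurableEquiv.measurable _)).aemeasurable (ae_of_all _ fun x => h _)
    have hcons : Measurable fun q : S × (Fin n → S) => (Fin.cons q.1 q.2 : Fin (n + 1) → S) := by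
      simp only [← hsymm]
      exact (MeasurableEquiv.piFinSuccAbove (fun _ : Fin (n + 1) => S) 0).symm.measurable
    have hms : ∀ s, Measurable fun y : Fin n → S => F (Fin.cons s y) := fun s =>
      hm.comp (hcons.comp measurable_prodMk_left)
    -- `G` is the conditional expectation of `F` given the first coordinate. It inherits oscillation
    -- at most `c`, so Hoeffding's lemma applies to it, while the induction hypothesis handles `F -
    -- G` with the first coordinate frozen.
    set G : S → ℝ := fun s => ∫ y, F (Fin.cons s y) ∂Measure.pi (fun _ : Fin n => ν) with hG
    have hGm : Measurable G :=
      ((hm.comp hcons).stronglyMeasurable.integral_prod_right'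
        (ν := Measure.pi (fun _ : Fin n => ν))).measurable
    have hint : ∀ s, Integrable (fun y => F (Fin.cons s y)) (Measure.pi fun _ : Fin n => ν) :=
      fun s => Integrable.of_mem_Icc a b (hms s).aemeasurable (ae_of_all _ fun y => hab _)
    have hGc : ∀ s s', G s ≤ G s' + c := by
      intro s s'
      have : G s' + c = ∫ y, (F (Fin.cons s' y) + c) ∂Measure.pi (fun _ : Fin n => ν) := by
        rw [integral_add (hint s') (integrable_const _)]; simp [hG]
      rw [this]
      refine integral_mono (hint s) ((hint s').add (integrable_const _)) fun y => ?_
      have := hF (Fin.cons s' y) 0 s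
      rw [Fin.update_cons_zero] at this
      linarith [(abs_le.1 this).2]
    have hGab : ∀ s, G s ∈ Set.Icc a b := by
      intro s
      have h1 := integral_mono (integrable_const a) (hint s) (fun y => (hab (Fin.cons s y)).1)
      have h2 := integral_mono (hint s) (integrable_const b) (fun y => (hab (Fin.cons s y)).2)
      simp at h1 h2
      exact ⟨h1, h2⟩
    have hEF : ∫ y, F y ∂Measure.pi (fun _ : Fin (n + 1) => ν) = ∫ s, G s ∂ν :=
      key F hm ⟨a, b, hab⟩
    set m := ∫ s, G s ∂ν with hmdef
    rw [hEF, key]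
    rotate_left
    · fun_prop
    · refine ⟨0, Real.exp (|l| * (|a| + |b| + |m|)), fun x => ⟨(Real.exp_pos _).le, ?_⟩⟩
      refine Real.exp_le_exp.2 ((le_abs_self _).trans ?_)
      rw [abs_mul]
      gcongr
      refine (abs_sub _ _).trans ?_
      gcongr
      have := hab x
      exact (abs_le_max_abs_abs this.1 this.2).trans
        (max_le (by linarith [abs_nonneg b]) (by linarith [abs_nonneg a]))
    have : Nonempty S := by
      by_contra h
      rw [not_nonempty_iff] at h
      exact IsProbabilityMeasure.ne_zero ν (Measure.eq_zero_of_isEmpty ν)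
    have hbdd : BddBelow (Set.range G) := ⟨a, by rintro _ ⟨s, rfl⟩; exact (hGab s).1⟩
    -- An interval of length exactly `c`, anchored at the infimum, is what yields the sharp `c ^ 2 /
    -- 8`; the crude range `[a, b]` only serves integrability.
    have hinf : ∀ s, G s ∈ Set.Icc (⨅ s, G s) ((⨅ s, G s) + c) := fun s =>
      ⟨ciInf_le hbdd s, by
        have : G s - c ≤ ⨅ s, G s := le_ciInf fun s' => by linarith [hGc s s']
        linarith⟩
    have hoef := hasSubgaussianMGF_of_mem_Icc hGm.aemeasurable (ae_of_all ν hinf)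
    have hlast := hoef.mgf_le l
    simp only [mgf] at hlast
    calc ∫ s, ∫ y, Real.exp (l * (F (Fin.cons s y) - m)) ∂Measure.pi (fun _ : Fin n => ν) ∂ν
        ≤ ∫ s, Real.exp (l * (G s - m)) * Real.exp (n * (c ^ 2 / 8) * l ^ 2) ∂ν := by
          refine integral_mono_of_nonneg (ae_of_all _ fun s => integral_nonneg fun y =>
            (Real.exp_pos _).le) ((hoef.integrable_exp_mul l).mul_const _) (ae_of_all _ fun s => ?_)
          have h1 : ∀ y, Real.exp (l * (F (Fin.cons s y) - m)) =
              Real.exp (l * (G s - m)) * Real.exp (l * (F (Fin.cons s y) - G s)) := fun y => by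
            rw [← Real.exp_add]; ring_nf
          simp only [h1, integral_const_mul]
          refine mul_le_mul_of_nonneg_left ?_ (Real.exp_pos _).le
          exact ih (hms s) (fun z t u => by rw [Fin.cons_update]; exact hF _ _ _)
      _ = (∫ s, Real.exp (l * (G s - m)) ∂ν) * Real.exp (n * (c ^ 2 / 8) * l ^ 2) :=
          integral_mul_const _ _
      _ ≤ Real.exp ((‖(⨅ s, G s) + c - ⨅ s, G s‖₊ / 2 : NNReal) ^ 2 * l ^ 2 / 2) *
            Real.exp (n * (c ^ 2 / 8) * l ^ 2) := by
          refine mul_le_mul_of_nonneg_right ?_ (Real.exp_pos _).le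
          exact_mod_cast hlast
      _ = _ := by
          rw [← Real.exp_add]
          congr 1
          simp [div_pow]
          ring

/-- **McDiarmid's inequality**. -/
theorem measure_sub_integral_ge_le {S : Type*} [MeasurableSpace S] (ν : Measure S)
    [IsProbabilityMeasure ν] {n : ℕ} {F : (Fin n → S) → ℝ} (hm : Measurable F) {c : ℝ}
    (hF : ∀ x t s, |F (Function.update x t s) - F x| ≤ c) {ε : ℝ} (hε : 0 ≤ ε) :
    (Measure.pi fun _ : Fin n => ν).real
      {x | ε ≤ F x - ∫ y, F y ∂Measure.pi (fun _ : Fin n => ν)} ≤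
        Real.exp (-(2 * ε ^ 2 / (n * c ^ 2))) := by
  obtain ⟨a, b, hab⟩ := memIcc_of_boundedDifferences hF
  have h : HasSubgaussianMGF (fun x => F x - ∫ y, F y ∂Measure.pi (fun _ : Fin n => ν))
      (⟨n * (c ^ 2 / 4), by positivity⟩ : NNReal) (Measure.pi fun _ : Fin n => ν) := by
    constructor
    · intro l
      refine integrable_exp_mul_of_mem_Icc (a := a - ∫ y, F y ∂Measure.pi (fun _ : Fin n => ν))
        (b := b - ∫ y, F y ∂Measure.pi (fun _ : Fin n => ν)) (by fun_prop) (ae_of_all _ fun x => ?_)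
      have := hab x
      constructor <;> linarith [this.1, this.2]
    · intro l
      refine (mgf_le_of_boundedDifferences ν hm hF l).trans_eq ?_
      congr 1
      change n * (c ^ 2 / 8) * l ^ 2 = n * (c ^ 2 / 4) * l ^ 2 / 2
      ring
  refine (h.measure_ge_le hε).trans_eq ?_
  congr 1
  change -ε ^ 2 / (2 * (n * (c ^ 2 / 4))) = _
  rw [neg_div, show 2 * ((n : ℝ) * (c ^ 2 / 4)) = n * c ^ 2 / 2 by ring, div_div_eq_mul_div]
  ring

theorem measure_abs_sub_integral_ge_le {S : Type*} [MeasurableSpace S] (ν : Measure S)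
    [IsProbabilityMeasure ν] {n : ℕ} {F : (Fin n → S) → ℝ} (hm : Measurable F) {c : ℝ}
    (hF : ∀ x t s, |F (Function.update x t s) - F x| ≤ c) {ε : ℝ} (hε : 0 ≤ ε) :
    (Measure.pi fun _ : Fin n => ν).real
      {x | ε ≤ |F x - ∫ y, F y ∂Measure.pi (fun _ : Fin n => ν)|} ≤
        2 * Real.exp (-(2 * ε ^ 2 / (n * c ^ 2))) := by
  have h1 := measure_sub_integral_ge_le ν hm hF hε
  have h2 := measure_sub_integral_ge_le ν (F := fun x => -F x) hm.neg
    (fun x t s => by rw [neg_sub_neg, abs_sub_comm]; exact hF x t s) hε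
  rw [two_mul]
  refine le_trans (measureReal_mono (fun x hx => ?_) (measure_ne_top _ _)) <|
    (measureReal_union_le _ _).trans (add_le_add h1 h2)
  rcases le_abs.1 (show ε ≤ |_| from hx) with h | h
  · exact Or.inl h
  · right
    simp only [Set.mem_ofPred_eq, integral_neg]
    linarith

/-! ### Empirical counts and bounded differences of the plug-in information -/

open scoped Classical in
/-- The number of occurrences of `a` in the sample `y`. -/
noncomputable def count {A : Type*} {n : ℕ} (y : Fin n → A) (a : A) : ℕ :=
  (Finset.univ.filter fun t => y t = a).card

/-- The empirical mass function of the sample `y`. -/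
noncomputable def freq {A : Type*} {n : ℕ} (y : Fin n → A) (a : A) : ℝ := (count y a : ℝ) / n

/-- The logarithmic multiplicities of a sample, summed over the sample: `n * (log n - H)`, where `H`
is the empirical entropy. -/
noncomputable def sumLogCount {A : Type*} {n : ℕ} (y : Fin n → A) : ℝ :=
  ∑ t, Real.log (count y (y t))

section

variable {A : Type*} {n : ℕ}

theorem count_self_pos (y : Fin n → A) (t : Fin n) : 0 < count y (y t) := by
  classical
  exact Finset.card_pos.2 ⟨t, by simp⟩

theorem count_le (y : Fin n → A) (a : A) : count y a ≤ n := by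
  classical
  exact (Finset.card_le_univ _).trans_eq (Fintype.card_fin n)

theorem freq_self_pos (y : Fin n → A) (t : Fin n) : 0 < freq y (y t) :=
  div_pos (by exact_mod_cast count_self_pos y t) (by exact_mod_cast Fin.pos t)

theorem freq_nonneg (y : Fin n → A) (a : A) : 0 ≤ freq y a := by
  unfold freq; positivity

theorem freq_le_one (y : Fin n → A) (a : A) : freq y a ≤ 1 :=
  div_le_one_of_le₀ (by exact_mod_cast count_le y a) (Nat.cast_nonneg n)

theorem freq_eq_sum (y : Fin n → A) (a : A) :
    freq y a = (∑ t, Set.indicator {a} (fun _ => (1 : ℝ)) (y t)) / n := by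
  classical
  rw [freq, count, Finset.card_eq_sum_ones, Finset.sum_filter]
  push_cast
  congr 1

/-- The empirical law has finite support, so sums against it over an infinite alphabet converge and
are sample means. -/
theorem hasSum_freq_mul (y : Fin n → A) (g : A → ℝ) :
    HasSum (fun a => freq y a * g a) ((∑ t, g (y t)) / n) := by
  have h : HasSum (fun a => ∑ t, Set.indicator {a} (fun _ => (1 : ℝ)) (y t) * g a / n)
      (∑ t, g (y t) / n) := by
    refine hasSum_sum fun t _ => ?_
    convert hasSum_single (y t) (f := fun a => Set.indicator {a} (fun _ => (1 : ℝ)) (y t) * g a / n)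
      (fun b hb => ?_) using 1
    · simp
    · simp [Set.indicator_of_notMem (show y t ∉ ({b} : Set A) from fun h => hb h.symm)]
  rw [← Finset.sum_div] at h
  refine h.congr_fun fun a => ?_
  rw [freq_eq_sum, Finset.sum_div, Finset.sum_mul]
  exact Finset.sum_congr rfl fun t _ => by ring

theorem sumLogCount_eq_sum (y : Fin n → A) (W : Finset A) (hW : ∀ t, y t ∈ W) :
    sumLogCount y = ∑ a ∈ W, (count y a : ℝ) * Real.log (count y a) := by
  classical
  rw [sumLogCount, ← Finset.sum_fiberwise_of_maps_to (t := W) (g := y) (fun t _ => hW t)]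
  refine Finset.sum_congr rfl fun a _ => ?_
  rw [Finset.sum_congr rfl (g := fun _ => Real.log (count y a)) (fun t ht => by
    rw [(Finset.mem_filter.1 ht).2]), Finset.sum_const, nsmul_eq_mul]
  congr 2

/-- The increment of `m log m` is `log (m + 1) + m (log (m + 1) - log m)`, and the second term lies
in `[0, 1]` since `log (1 + 1 / m) ≤ 1 / m`. -/
theorem mul_log_succ_sub_mem_Icc (m : ℕ) :
    ((m + 1 : ℕ) : ℝ) * Real.log (m + 1 : ℕ) - m * Real.log m ∈
      Set.Icc 0 (Real.log (m + 1 : ℕ) + 1) := by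
  rcases Nat.eq_zero_or_pos m with rfl | hm
  · simp
  have hm' : (0 : ℝ) < m := by exact_mod_cast hm
  have h0 : 0 ≤ Real.log (m + 1 : ℕ) := Real.log_natCast_nonneg _
  have h1 : Real.log m ≤ Real.log (m + 1 : ℕ) := Real.log_le_log hm' (by simp)
  have h2 : Real.log (m + 1 : ℕ) - Real.log m ≤ 1 / m := by
    rw [← Real.log_div (by positivity) hm'.ne']
    refine (Real.log_le_sub_one_of_pos (by positivity)).trans_eq ?_
    push_cast
    field_simp
    ring
  have h3 : (m : ℝ) * (Real.log (m + 1 : ℕ) - Real.log m) ≤ 1 :=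
    (mul_le_mul_of_nonneg_left h2 hm'.le).trans_eq (by field_simp)
  have h4 : 0 ≤ (m : ℝ) * (Real.log (m + 1 : ℕ) - Real.log m) :=
    mul_nonneg hm'.le (sub_nonneg.2 h1)
  have h5 : ((m + 1 : ℕ) : ℝ) * Real.log (m + 1 : ℕ) =
    m * Real.log (m + 1 : ℕ) + Real.log (m + 1 : ℕ) := by rw [Nat.cast_succ]; ring
  constructor <;> linarith

/-- Both samples arise from the same `n - 1` points by inserting one. Each insertion adds an
increment of `m log m` in `[0, log n + 1]`, and two numbers of that interval differ by at most its
length, not twice it. -/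
theorem abs_sumLogCount_update_sub_le (y : Fin n → A) (t : Fin n) (s : A) :
    |sumLogCount (Function.update y t s) - sumLogCount y| ≤ Real.log n + 1 := by
  classical
  set y' := Function.update y t s
  set W : Finset A := Finset.univ.image y ∪ Finset.univ.image y' with hW
  -- The counts with position `t` left out, common to both samples; `W` is a finite set containing
  -- all the values of both.
  let M : A → ℕ := fun a => ((Finset.univ.erase t).filter fun u => y u = a).card
  have key : ∀ x : Fin n → A, (∀ u, u ≠ t → x u = y u) → (∀ u, x u ∈ W) →
      sumLogCount x - ∑ a ∈ W, (M a : ℝ) * Real.log (M a) ∈ Set.Icc 0 (Real.log n + 1) := by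
    intro x hx hxW
    have hc : ∀ a, count x a = M a + if a = x t then 1 else 0 := by
      intro a
      have h1 : count x a = ((Finset.univ : Finset (Fin n)).filter fun u => x u = a).card := by
        unfold count; congr
      rw [h1, ← Finset.insert_erase (Finset.mem_univ t), Finset.filter_insert]
      have h2 : (Finset.univ.erase t).filter (fun u => x u = a) =
          (Finset.univ.erase t).filter fun u => y u = a :=
        Finset.filter_congr fun u hu => by rw [hx u (Finset.ne_of_mem_erase hu)]
      rw [h2]
      by_cases h : x t = a
      · rw [if_pos h, if_pos h.symm, Finset.card_insert_of_notMem (by simp)]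
      · rw [if_neg h, if_neg (Ne.symm h)]; simp [M]
    rw [sumLogCount_eq_sum x W hxW, ← Finset.sum_sub_distrib,
      Finset.sum_eq_single_of_mem (x t) (hxW t) (fun a _ ha => by rw [hc a, if_neg ha]; simp)]
    have h1 := mul_log_succ_sub_mem_Icc (M (x t))
    have h2 : count x (x t) = M (x t) + 1 := by rw [hc, if_pos rfl]
    rw [← h2] at h1
    refine ⟨h1.1, h1.2.trans ?_⟩
    gcongr
    · exact_mod_cast count_self_pos x t
    · exact_mod_cast count_le x _
  have h1 := key y (fun _ _ => rfl) fun u => by simp [hW]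
  have h2 := key y' (fun u hu => Function.update_of_ne hu _ _) fun u => by simp [hW]
  rw [abs_le]
  constructor <;> linarith [h1.1, h1.2, h2.1, h2.2]

end

section

variable {p n : ℕ} {α : Type*}

theorem empMarginal_eq_freq (z : Fin n → Fin p → α) (i : Fin p) (k : α) :
    empMarginal z i k = freq (fun t => z t i) k := rfl

theorem empPairMarginal_eq_freq (z : Fin n → Fin p → α) (i j : Fin p) (k l : α) :
    empPairMarginal z i j k l = freq (fun t => (z t i, z t j)) (k, l) := by
  simp only [empPairMarginal, freq, count]
  congr 3
  ext t
  simp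

theorem empPairInfo_eq_sum (z : Fin n → Fin p → α) (i j : Fin p) :
    empPairInfo z i j = (∑ t, Real.logb 2 (freq (fun t => (z t i, z t j)) (z t i, z t j) /
      (freq (fun t => z t i) (z t i) * freq (fun t => z t j) (z t j)))) / n := by
  have h := hasSum_freq_mul (fun t => (z t i, z t j)) fun a : α × α =>
    Real.logb 2 (freq (fun t => (z t i, z t j)) a /
      (freq (fun t => z t i) a.1 * freq (fun t => z t j) a.2))
  rw [← h.tsum_eq]
  simp only [empPairInfo, mutualInfo, empMarginal_eq_freq, empPairMarginal_eq_freq]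

theorem empPairInfo_mul_log_two (hn : 0 < n) (z : Fin n → Fin p → α) (i j : Fin p) :
    empPairInfo z i j * Real.log 2 = (sumLogCount (fun t => (z t i, z t j)) -
      sumLogCount (fun t => z t i) - sumLogCount (fun t => z t j)) / n + Real.log n := by
  have hn' : (0 : ℝ) < n := by exact_mod_cast hn
  have h2 : Real.log 2 ≠ 0 := (Real.log_pos one_lt_two).ne'
  have h : ∀ t, Real.logb 2 (freq (fun t => (z t i, z t j)) (z t i, z t j) /
      (freq (fun t => z t i) (z t i) * freq (fun t => z t j) (z t j))) * Real.log 2 =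
      Real.log (count (fun t => (z t i, z t j)) (z t i, z t j)) -
        Real.log (count (fun t => z t i) (z t i)) - Real.log (count (fun t => z t j) (z t j)) +
        Real.log n := by
    intro t
    have a1 : (0 : ℝ) < count (fun t => (z t i, z t j)) (z t i, z t j) := by
      exact_mod_cast count_self_pos (fun t => (z t i, z t j)) t
    have a2 : (0 : ℝ) < count (fun t => z t i) (z t i) := by
      exact_mod_cast count_self_pos (fun t => z t i) t
    have a3 : (0 : ℝ) < count (fun t => z t j) (z t j) := by
      exact_mod_cast count_self_pos (fun t => z t j) t
    rw [Real.logb, div_mul_cancel₀ _ h2]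
    unfold freq
    rw [Real.log_div (by positivity) (by positivity), Real.log_mul (by positivity) (by positivity),
      Real.log_div a1.ne' hn'.ne', Real.log_div a2.ne' hn'.ne', Real.log_div a3.ne' hn'.ne']
    ring
  rw [empPairInfo_eq_sum, div_mul_eq_mul_div, Finset.sum_mul, Finset.sum_congr rfl fun t _ => h t]
  simp only [Finset.sum_add_distrib, Finset.sum_sub_distrib, sumLogCount, Finset.sum_const,
    Finset.card_univ, Fintype.card_fin, nsmul_eq_mul]
  field_simp

/-- The factor 3 counts the joint and the two marginal entropy terms; the constant `log n` cancels.
-/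
theorem abs_empPairInfo_update_sub_le (z : Fin n → Fin p → α) (i j : Fin p) (t : Fin n)
    (s : Fin p → α) :
    |empPairInfo (Function.update z t s) i j - empPairInfo z i j| ≤
      3 * (Real.log n + 1) / (n * Real.log 2) := by
  have hn : 0 < n := Fin.pos t
  have hn' : (0 : ℝ) < n := by exact_mod_cast hn
  have h2 : 0 < Real.log 2 := Real.log_pos one_lt_two
  have hup : ∀ {B : Type _} (f : (Fin p → α) → B),
      |sumLogCount (fun u => f (Function.update z t s u)) - sumLogCount (fun u => f (z u))| ≤
        Real.log n + 1 := by
    intro B f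
    have : (fun u => f (Function.update z t s u)) = Function.update (fun u => f (z u)) t (f s) :=
      Function.comp_update f z t s
    rw [this]
    exact abs_sumLogCount_update_sub_le _ _ _
  have e1 := abs_le.1 (hup fun x => (x i, x j))
  have e2 := abs_le.1 (hup fun x => x i)
  have e3 := abs_le.1 (hup fun x => x j)
  rw [le_div_iff₀ (by positivity), ← abs_of_pos (show 0 < n * Real.log 2 by positivity), ← abs_mul]
  have : (empPairInfo (Function.update z t s) i j - empPairInfo z i j) * (n * Real.log 2) =
      n * (empPairInfo (Function.update z t s) i j * Real.log 2) -
        n * (empPairInfo z i j * Real.log 2) := by ring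
  rw [this, empPairInfo_mul_log_two hn, empPairInfo_mul_log_two hn, mul_add, mul_add,
    mul_div_cancel₀ _ hn'.ne', mul_div_cancel₀ _ hn'.ne', abs_le]
  constructor <;> linarith [e1.1, e1.2, e2.1, e2.2, e3.1, e3.2]

end

/-! ### Expected divergence between the empirical and the true law -/

/-- The normalized log-likelihood ratio of a sample between its empirical mass function and `q`,
that is, the Kullback-Leibler divergence from `q` to the empirical mass function. -/
noncomputable def empDiv {A : Type*} {n : ℕ} (q : A → ℝ) (y : Fin n → A) : ℝ :=
  (∑ t, Real.log (freq y (y t) / q (y t))) / n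

theorem sub_le_mul_log_div {x q : ℝ} (hx : 0 ≤ x) (hq : 0 < q) : x - q ≤ x * Real.log (x / q) := by
  rcases hx.eq_or_lt with rfl | hx
  · simp [hq.le]
  have h := Real.one_sub_inv_le_log_of_pos (div_pos hx hq)
  calc x - q = x * (1 - (x / q)⁻¹) := by field_simp
    _ ≤ _ := mul_le_mul_of_nonneg_left h hx.le

/-- The tangent bound `log u ≤ u - 1` at `u = x / (q r)`. The free parameter `r` allows the
right-hand side, quadratic in `x`, to be optimized after taking expectations. -/
theorem mul_log_div_le {x q r : ℝ} (hx : 0 ≤ x) (hq : 0 < q) (hr : 0 < r) :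
    x * Real.log (x / q) ≤ x * (Real.log r - 1) + x ^ 2 / (q * r) := by
  rcases hx.eq_or_lt with rfl | hx
  · simp
  have h := Real.log_le_sub_one_of_pos (div_pos (div_pos hx hq) hr)
  rw [Real.log_div (div_pos hx hq).ne' hr.ne'] at h
  calc x * Real.log (x / q) ≤ x * (Real.log r - 1 + x / q / r) :=
        mul_le_mul_of_nonneg_left (by linarith) hx.le
    _ = _ := by field_simp

section

variable {A : Type*} {n : ℕ}

/-- The correction `- freq + q` sums to zero, but makes each term nonnegative by
`sub_le_mul_log_div`. This gives nonnegativity of the divergence and permits Tonelli. -/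
theorem hasSum_empDiv (hn : 0 < n) {q : A → ℝ} (hq : HasSum q 1) (y : Fin n → A) :
    HasSum (fun a => freq y a * Real.log (freq y a / q a) - freq y a + q a) (empDiv q y) := by
  have h1 := hasSum_freq_mul y fun a => Real.log (freq y a / q a)
  have h2 := hasSum_freq_mul y fun _ => (1 : ℝ)
  have hn' : (n : ℝ) ≠ 0 := by exact_mod_cast hn.ne'
  simp only [mul_one, Finset.sum_const, Finset.card_univ, Fintype.card_fin, nsmul_eq_mul,
    div_self hn'] at h2
  have := (h1.sub h2).add hq
  rw [sub_add_cancel] at this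
  exact this

variable {S : Type*} [MeasurableSpace S] {ν : Measure S} [IsProbabilityMeasure ν]

theorem measurable_freq_comp [DiscreteMeasurableSpace S] (f : S → A) (a : A) :
    Measurable fun z : Fin n → S => freq (fun t => f (z t)) a := by
  simp only [freq_eq_sum]
  refine (Finset.measurable_sum _ fun t _ => ?_).div_const _
  exact (Measurable.of_discrete (f := fun s => Set.indicator {a} (fun _ => (1 : ℝ)) (f s))).comp
    (measurable_pi_apply t)

theorem integrable_freq_comp [DiscreteMeasurableSpace S] (f : S → A) (a : A) :
    Integrable (fun z : Fin n → S => freq (fun t => f (z t)) a) (Measure.pi fun _ => ν) :=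
  Integrable.of_mem_Icc 0 1 (measurable_freq_comp f a).aemeasurable
    (ae_of_all _ fun _ => ⟨freq_nonneg _ _, freq_le_one _ _⟩)

theorem integrable_freq_comp_sq [DiscreteMeasurableSpace S] (f : S → A) (a : A) :
    Integrable (fun z : Fin n → S => freq (fun t => f (z t)) a ^ 2) (Measure.pi fun _ => ν) :=
  Integrable.of_mem_Icc 0 1 ((measurable_freq_comp f a).pow_const 2).aemeasurable
    (ae_of_all _ fun _ => ⟨sq_nonneg _, pow_le_one₀ (freq_nonneg _ _) (freq_le_one _ _)⟩)

theorem integral_freq_comp [DiscreteMeasurableSpace S] (hn : 0 < n) (f : S → A) (a : A) :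
    ∫ z : Fin n → S, freq (fun t => f (z t)) a ∂Measure.pi (fun _ => ν) = ν.real (f ⁻¹' {a}) := by
  have hn' : (n : ℝ) ≠ 0 := by exact_mod_cast hn.ne'
  have h : ∀ s, Set.indicator {a} (fun _ => (1 : ℝ)) (f s) =
    Set.indicator (f ⁻¹' {a}) (fun _ => (1 : ℝ)) s := fun _ => rfl
  have hm : Measurable fun s => Set.indicator (f ⁻¹' {a}) (fun _ => (1 : ℝ)) s :=
    Measurable.of_discrete
  simp only [freq_eq_sum, h, integral_div]
  rw [integral_finsetSum]
  · have : ∀ t : Fin n, ∫ z : Fin n → S, Set.indicator (f ⁻¹' {a}) (fun _ => (1 : ℝ)) (z t)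
        ∂Measure.pi (fun _ => ν) = ν.real (f ⁻¹' {a}) := fun t => by
      rw [integral_comp_eval (μ := fun _ : Fin n => ν)
        (f := fun s => Set.indicator (f ⁻¹' {a}) (fun _ => (1 : ℝ)) s) hm.aestronglyMeasurable,
        integral_indicator_const _ (MeasurableSet.of_discrete)]
      simp
    simp only [this, Finset.sum_const, Finset.card_univ, Fintype.card_fin, nsmul_eq_mul]
    field_simp
  · intro t _
    refine Integrable.of_mem_Icc 0 1 (hm.comp (measurable_pi_apply t)).aemeasurable
      (ae_of_all _ fun z => ?_)
    by_cases hz : z t ∈ f ⁻¹' {a} <;> simp [Set.indicator, hz]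

/-- Squared mean plus variance, the latter at most `q / n` by independence. -/
theorem integral_freq_comp_sq_le [DiscreteMeasurableSpace S] (hn : 0 < n) (f : S → A) (a : A) :
    ∫ z : Fin n → S, freq (fun t => f (z t)) a ^ 2 ∂Measure.pi (fun _ => ν) ≤
      ν.real (f ⁻¹' {a}) ^ 2 + ν.real (f ⁻¹' {a}) / n := by
  have hn' : (n : ℝ) ≠ 0 := by exact_mod_cast hn.ne'
  set q := ν.real (f ⁻¹' {a}) with hq
  have hX : MemLp (fun s => Set.indicator (f ⁻¹' {a}) (fun _ => (1 : ℝ)) s / n) 2 ν := by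
    refine MemLp.of_bound (C := 1) (Measurable.of_discrete).aestronglyMeasurable
      (ae_of_all _ fun s => ?_)
    have : (1 : ℝ) ≤ n := by exact_mod_cast hn
    by_cases hz : s ∈ f ⁻¹' {a} <;> simp [Set.indicator, hz]
    exact inv_le_one_of_one_le₀ this
  have hv := variance_sum_pi (ι := Fin n) (μ := fun _ => ν) (fun _ => hX)
  have hfun : (∑ i : Fin n, fun z : Fin n → S =>
      Set.indicator (f ⁻¹' {a}) (fun _ => (1 : ℝ)) (z i) / n) =
      fun z => freq (fun t => f (z t)) a := by
    ext z
    simp only [Finset.sum_apply, freq_eq_sum, Finset.sum_div]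
    rfl
  have hvar : Var[fun s => Set.indicator (f ⁻¹' {a}) (fun _ => (1 : ℝ)) s / n; ν] ≤
      q / n ^ 2 := by
    refine (variance_le_expectation_sq (Measurable.of_discrete).aestronglyMeasurable).trans_eq ?_
    have : (fun s => Set.indicator (f ⁻¹' {a}) (fun _ => (1 : ℝ)) s / n) ^ 2 =
        fun s => Set.indicator (f ⁻¹' {a}) (fun _ => ((n : ℝ) ^ 2)⁻¹) s := by
      ext s
      by_cases hz : s ∈ f ⁻¹' {a} <;> simp [Set.indicator, hz]
    rw [this, integral_indicator_const _ (MeasurableSet.of_discrete), smul_eq_mul, ← hq,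
      div_eq_mul_inv]
  rw [hfun, variance_eq_sub] at hv
  · have he : ∫ z : Fin n → S, freq (fun t => f (z t)) a ∂Measure.pi (fun _ => ν) = q :=
      integral_freq_comp hn f a
    rw [he] at hv
    have h1 : ∑ _i : Fin n, Var[fun s => Set.indicator (f ⁻¹' {a}) (fun _ => (1 : ℝ)) s / n; ν] ≤
        q / n := by
      rw [Finset.sum_const, Finset.card_univ, Fintype.card_fin, nsmul_eq_mul]
      calc (n : ℝ) * _ ≤ n * (q / n ^ 2) := mul_le_mul_of_nonneg_left hvar (by positivity)
        _ = q / n := by field_simp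
    have h2 : ∫ z : Fin n → S, freq (fun t => f (z t)) a ^ 2 ∂Measure.pi (fun _ => ν) =
      ∫ z : Fin n → S, ((fun z => freq (fun t => f (z t)) a) ^ 2) z ∂Measure.pi (fun _ => ν) := rfl
    rw [h2]
    linarith
  · refine MemLp.of_bound (C := 1) (measurable_freq_comp f a).aestronglyMeasurable
      (ae_of_all _ fun z => ?_)
    rw [Real.norm_of_nonneg (freq_nonneg _ _)]
    exact freq_le_one _ _

theorem empDiv_nonneg (hn : 0 < n) {q : A → ℝ} (hq : HasSum q 1) (hpos : ∀ a, 0 < q a)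
    (y : Fin n → A) : 0 ≤ empDiv q y :=
  (hasSum_empDiv hn hq y).nonneg fun a => by
    linarith [sub_le_mul_log_div (freq_nonneg y a) (hpos a)]

/-- The expected divergence between the empirical law and the true law. -/
theorem integral_empDiv_le [Countable S] [DiscreteMeasurableSpace S] [Countable A] (hn : 0 < n)
    (f : S → A) {q : A → ℝ} (hqν : ∀ a, q a = ν.real (f ⁻¹' {a})) (hq : HasSum q 1)
    (hpos : ∀ a, 0 < q a) (hs : Summable fun a => q a * Real.log (1 + 1 / (n * q a))) :
    Integrable (fun z : Fin n → S => empDiv q fun t => f (z t)) (Measure.pi fun _ => ν) ∧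
    ∫ z : Fin n → S, empDiv q (fun t => f (z t)) ∂Measure.pi (fun _ => ν) ≤
      ∑' a, q a * Real.log (1 + 1 / (n * q a)) := by
  have hn' : (0 : ℝ) < n := by exact_mod_cast hn
  have hφ : ∀ a, 0 ≤ q a * Real.log (1 + 1 / (n * q a)) := fun a =>
    mul_nonneg (hpos a).le (Real.log_nonneg (by
      have := hpos a
      have : 0 ≤ 1 / (n * q a) := by positivity
      linarith))
  have h0 : ∀ᵐ z : Fin n → S ∂Measure.pi (fun _ => ν), 0 ≤ empDiv q fun t => f (z t) :=
    ae_of_all _ fun z => empDiv_nonneg hn hq hpos _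
  -- A bound on the Lebesgue integral gives integrability and the estimate at once.
  suffices hL : ∫⁻ z : Fin n → S, ENNReal.ofReal (empDiv q fun t => f (z t))
      ∂Measure.pi (fun _ => ν) ≤ ENNReal.ofReal (∑' a, q a * Real.log (1 + 1 / (n * q a))) by
    refine ⟨⟨(Measurable.of_discrete).aestronglyMeasurable, ?_⟩, ?_⟩
    · exact (hasFiniteIntegral_iff_ofReal h0).2 (hL.trans_lt ENNReal.ofReal_lt_top)
    · rw [integral_eq_lintegral_of_nonneg_ae h0 (Measurable.of_discrete).aestronglyMeasurable]
      exact ENNReal.toReal_le_of_le_ofReal (tsum_nonneg hφ) hL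
  have hd : ∀ (z : Fin n → S) a, 0 ≤ freq (fun t => f (z t)) a *
      Real.log (freq (fun t => f (z t)) a / q a) - freq (fun t => f (z t)) a + q a := fun z a => by
    linarith [sub_le_mul_log_div (freq_nonneg (fun t => f (z t)) a) (hpos a)]
  calc ∫⁻ z : Fin n → S, ENNReal.ofReal (empDiv q fun t => f (z t)) ∂Measure.pi (fun _ => ν)
      = ∫⁻ z : Fin n → S, ∑' a, ENNReal.ofReal (freq (fun t => f (z t)) a *
          Real.log (freq (fun t => f (z t)) a / q a) - freq (fun t => f (z t)) a + q a)
          ∂Measure.pi (fun _ => ν) := by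
        refine lintegral_congr fun z => ?_
        have h := hasSum_empDiv hn hq fun t => f (z t)
        rw [← h.tsum_eq, ENNReal.ofReal_tsum_of_nonneg (hd z) h.summable]
    _ = ∑' a, ∫⁻ z : Fin n → S, ENNReal.ofReal (freq (fun t => f (z t)) a *
          Real.log (freq (fun t => f (z t)) a / q a) - freq (fun t => f (z t)) a + q a)
          ∂Measure.pi (fun _ => ν) :=
        lintegral_tsum fun a => (Measurable.of_discrete).aemeasurable
    _ ≤ ∑' a, ENNReal.ofReal (q a * Real.log (1 + 1 / (n * q a))) := by
        refine ENNReal.tsum_le_tsum fun a => ?_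
        have hqa := hpos a
        -- With this `r` the second moment bound `q² + q / n` equals `q² r`, so the quadratic term
        -- has mean at most `q`. All terms except `q log r` then cancel.
        set r := 1 + 1 / (n * q a) with hr
        have hrpos : 0 < r := by positivity
        have hle : ∀ z : Fin n → S, freq (fun t => f (z t)) a *
            Real.log (freq (fun t => f (z t)) a / q a) - freq (fun t => f (z t)) a + q a ≤
            freq (fun t => f (z t)) a * (Real.log r - 1) +
              freq (fun t => f (z t)) a ^ 2 / (q a * r) - freq (fun t => f (z t)) a + q a :=
          fun z => by
            linarith [mul_log_div_le (freq_nonneg (fun t => f (z t)) a) hqa hrpos]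
        have i1 := (integrable_freq_comp (ν := ν) (n := n) f a).mul_const (Real.log r - 1)
        have i2 := (integrable_freq_comp_sq (ν := ν) (n := n) f a).div_const (q a * r)
        have i3 := integrable_freq_comp (ν := ν) (n := n) f a
        refine (lintegral_mono fun z => ENNReal.ofReal_le_ofReal (hle z)).trans ?_
        have i4 : Integrable (fun z : Fin n → S => freq (fun t => f (z t)) a * (Real.log r - 1) +
            freq (fun t => f (z t)) a ^ 2 / (q a * r) - freq (fun t => f (z t)) a + q a)
            (Measure.pi fun _ => ν) := ((i1.add i2).sub i3).add (integrable_const _)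
        have i5 : Integrable (fun z : Fin n → S => freq (fun t => f (z t)) a * (Real.log r - 1) +
            freq (fun t => f (z t)) a ^ 2 / (q a * r) - freq (fun t => f (z t)) a)
            (Measure.pi fun _ => ν) := (i1.add i2).sub i3
        have i6 : Integrable (fun z : Fin n → S => freq (fun t => f (z t)) a * (Real.log r - 1) +
            freq (fun t => f (z t)) a ^ 2 / (q a * r))
            (Measure.pi fun _ => ν) := i1.add i2
        rw [← ofReal_integral_eq_lintegral_ofReal i4
          (ae_of_all _ fun z => (hd z a).trans (hle z))]
        refine ENNReal.ofReal_le_ofReal ?_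
        rw [integral_add i5 (integrable_const _), integral_sub i6 i3, integral_add i1 i2, integral_mul_const, integral_div,
          integral_freq_comp hn, ← hqν]
        have h2 := integral_freq_comp_sq_le (ν := ν) hn f a
        rw [← hqν] at h2
        have h3 : (∫ z : Fin n → S, freq (fun t => f (z t)) a ^ 2 ∂Measure.pi fun _ => ν) /
            (q a * r) ≤ q a := by
          rw [div_le_iff₀ (by positivity)]
          refine h2.trans_eq ?_
          rw [hr]
          field_simp
        simp only [integral_const, probReal_univ, one_smul]
        linarith
    _ = _ := (ENNReal.ofReal_tsum_of_nonneg hφ hs).symm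

/-- The sample mean of a bounded function is unbiased. -/
theorem integral_sum_comp_div [Countable A] [MeasurableSpace A] [DiscreteMeasurableSpace A]
    [DiscreteMeasurableSpace S] (hn : 0 < n)
    (f : S → A) {q : A → ℝ} (hqν : ∀ a, q a = ν.real (f ⁻¹' {a})) {g : A → ℝ} {K : ℝ}
    (hg : ∀ a, |g a| ≤ K) :
    Integrable (fun z : Fin n → S => (∑ t, g (f (z t))) / n) (Measure.pi fun _ => ν) ∧
    ∫ z : Fin n → S, (∑ t, g (f (z t))) / n ∂Measure.pi (fun _ => ν) = ∑' a, q a * g a := by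
  have hn' : (n : ℝ) ≠ 0 := by exact_mod_cast hn.ne'
  have hi : ∀ t, Integrable (fun z : Fin n → S => g (f (z t))) (Measure.pi fun _ => ν) := fun t =>
    Integrable.of_bound (((Measurable.of_discrete (f := fun s => g (f s))).comp
      (measurable_pi_apply t)).aestronglyMeasurable) K (ae_of_all _ fun z => hg _)
  refine ⟨(integrable_finsetSum _ fun t _ => hi t).div_const _, ?_⟩
  rw [integral_div, integral_finsetSum _ fun t _ => hi t]
  have hfm : Measurable f := Measurable.of_discrete
  have h : ∀ t : Fin n, ∫ z : Fin n → S, g (f (z t)) ∂Measure.pi (fun _ => ν) =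
      ∑' a, q a * g a := fun t => by
    rw [integral_comp_eval (μ := fun _ : Fin n => ν) (f := fun s => g (f s))
      (Measurable.of_discrete).aestronglyMeasurable, ← integral_map (f := g) hfm.aemeasurable
      (Measurable.of_discrete).aestronglyMeasurable, integral_countable]
    · refine tsum_congr fun a => ?_
      rw [hqν, map_measureReal_apply hfm (MeasurableSet.of_discrete), smul_eq_mul]
    · have := Measure.isProbabilityMeasure_map (μ := ν) hfm.aemeasurable
      exact Integrable.of_bound (Measurable.of_discrete).aestronglyMeasurable K (ae_of_all _ hg)
  simp only [h, Finset.sum_const, Finset.card_univ, Fintype.card_fin, nsmul_eq_mul]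
  field_simp

end

/-! ### Estimates of the bias series for power laws -/

/-- Interpolates between `log (1 + y²) ≤ y²` for small `y` and logarithmic growth, at most `4 √(1 +
y)`, for large `y`. The resulting decay `(1 + y)^(-3/2)` is summable, with a bound that telescopes
explicitly. -/
theorem log_one_add_sq_mul_le {y : ℝ} (hy : 0 < y) :
    Real.log (1 + y ^ 2) * Real.sqrt (1 + y) ^ 3 ≤ 16 * y ^ 2 := by
  have h0 : 0 ≤ Real.log (1 + y ^ 2) := Real.log_nonneg (by nlinarith)
  have hs : 0 < Real.sqrt (1 + y) := Real.sqrt_pos.2 (by linarith)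
  have hs2 : Real.sqrt (1 + y) ^ 2 = 1 + y := Real.sq_sqrt (by linarith)
  set s := Real.sqrt (1 + y)
  rcases le_total y 1 with h | h
  · have h1 : Real.log (1 + y ^ 2) ≤ y ^ 2 := by
      linarith [Real.log_le_sub_one_of_pos (show 0 < 1 + y ^ 2 by positivity)]
    have h2 : s ≤ 2 := by nlinarith
    have h3 : s ^ 3 ≤ 16 := by
      calc s ^ 3 ≤ 2 ^ 3 := by gcongr
        _ ≤ 16 := by norm_num
    calc _ ≤ y ^ 2 * 16 := by gcongr
      _ = _ := mul_comm _ _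
  · have h1 : Real.log (1 + y ^ 2) ≤ 4 * s := by
      have : Real.log (1 + y ^ 2) ≤ Real.log (s ^ 4) := by
        apply Real.log_le_log (by positivity)
        rw [show s ^ 4 = (s ^ 2) ^ 2 by ring, hs2]
        nlinarith
      rw [Real.log_pow] at this
      have h3 := Real.log_le_sub_one_of_pos hs
      push_cast at this
      linarith
    calc _ ≤ 4 * s * s ^ 3 := by gcongr
      _ = 4 * (s ^ 2) ^ 2 := by ring
      _ ≤ 16 * y ^ 2 := by rw [hs2]; nlinarith

/-- The function `q ↦ q log (1 + 1 / (n q))` is nondecreasing. -/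
theorem mul_log_one_add_mono {n q r : ℝ} (hn : 0 < n) (hq : 0 < q) (hqr : q ≤ r) :
    q * Real.log (1 + 1 / (n * q)) ≤ r * Real.log (1 + 1 / (n * r)) := by
  have hr : 0 < r := hq.trans_le hqr
  have hx : 0 < 1 / (n * q) := by positivity
  -- Bernoulli's inequality with the exponent `q / r ≤ 1`.
  have h := rpow_one_add_le_one_add_mul_self (s := 1 / (n * q)) (by linarith)
    (p := q / r) (by positivity) ((div_le_one hr).2 hqr)
  have h2 := Real.log_le_log (Real.rpow_pos_of_pos (by linarith) _) h
  rw [Real.log_rpow (by linarith), show q / r * (1 / (n * q)) = 1 / (n * r) by field_simp] at h2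
  calc q * Real.log (1 + 1 / (n * q)) = r * (q / r * Real.log (1 + 1 / (n * q))) := by field_simp
    _ ≤ _ := by gcongr

/-- In the variable `y = m / √n` the left side is `log (1 + y²) / (n y²)`. -/
theorem mul_log_one_add_le {n m : ℝ} (hn : 0 < n) (hm : 0 < m) :
    1 / m ^ 2 * Real.log (1 + 1 / (n * (1 / m ^ 2))) ≤
      16 / n * (1 / Real.sqrt (1 + m / Real.sqrt n) ^ 3) := by
  have hsn : 0 < Real.sqrt n := Real.sqrt_pos.2 hn
  have hsn2 : Real.sqrt n ^ 2 = n := Real.sq_sqrt hn.le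
  set y := m / Real.sqrt n with hy
  have hy0 : 0 < y := by positivity
  have h := log_one_add_sq_mul_le hy0
  have hs : 0 < Real.sqrt (1 + y) := Real.sqrt_pos.2 (by linarith)
  have h1 : 1 / (n * (1 / m ^ 2)) = y ^ 2 := by rw [hy, div_pow, hsn2]; field_simp
  have h2 : 1 / m ^ 2 = 1 / (n * y ^ 2) := by rw [hy, div_pow, hsn2]; field_simp
  rw [h1, h2, div_mul_div_comm, one_div_mul_eq_div, div_le_div_iff₀ (by positivity) (by positivity)]
  calc Real.log (1 + y ^ 2) * (n * Real.sqrt (1 + y) ^ 3) =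
        n * (Real.log (1 + y ^ 2) * Real.sqrt (1 + y) ^ 3) := by ring
    _ ≤ n * (16 * y ^ 2) := by gcongr
    _ = _ := by ring

/-- Comparison with the integral of `(x + a t)^(-3/2)`, carried out by telescoping its
antiderivative. -/
theorem sum_one_div_sqrt_cube_le {x a : ℝ} (hx : 0 < x) (ha : 0 < a) (N : ℕ) :
    ∑ l ∈ Finset.range N, 1 / Real.sqrt (x + a * (l + 1)) ^ 3 ≤ 2 / (a * Real.sqrt x) := by
  have step : ∀ l : ℕ, 1 / Real.sqrt (x + a * (l + 1)) ^ 3 ≤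
      2 / (a * Real.sqrt (x + a * l)) - 2 / (a * Real.sqrt (x + a * (l + 1 : ℕ))) := by
    intro l
    have hu : 0 < Real.sqrt (x + a * l) := Real.sqrt_pos.2 (by positivity)
    have hv : 0 < Real.sqrt (x + a * (l + 1)) := Real.sqrt_pos.2 (by positivity)
    have hu2 : Real.sqrt (x + a * l) ^ 2 = x + a * l := Real.sq_sqrt (by positivity)
    have hv2 : Real.sqrt (x + a * (l + 1)) ^ 2 = x + a * (l + 1) := Real.sq_sqrt (by positivity)
    have huv : Real.sqrt (x + a * l) ≤ Real.sqrt (x + a * (l + 1)) :=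
      Real.sqrt_le_sqrt (by nlinarith)
    push_cast
    set u := Real.sqrt (x + a * l)
    set v := Real.sqrt (x + a * (l + 1))
    have hav : a = (v - u) * (v + u) := by
      have : (v - u) * (v + u) = v ^ 2 - u ^ 2 := by ring
      linarith
    have hd : 0 < v - u := by
      by_contra hc
      have : (v - u) * (v + u) ≤ 0 := mul_nonpos_of_nonpos_of_nonneg (by linarith) (by linarith)
      linarith
    have h1 : 2 / (a * u) - 2 / (a * v) = 2 / (u * v * (v + u)) := by
      rw [hav]; field_simp
    rw [h1, div_le_div_iff₀ (by positivity) (by positivity), one_mul]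
    calc u * v * (v + u) ≤ v * v * (v + v) := by gcongr
      _ = 2 * v ^ 3 := by ring
  refine (Finset.sum_le_sum fun l _ => step l).trans ?_
  rw [Finset.sum_range_sub' (fun l : ℕ => 2 / (a * Real.sqrt (x + a * l)))]
  have : 0 ≤ 2 / (a * Real.sqrt (x + a * N)) := by positivity
  simp only [Nat.cast_zero, mul_zero, add_zero]
  linarith

/-- The terms of the bias series of a law with masses `1 / (b m) ^ 2`. -/
noncomputable def biasTerm (b n m : ℝ) : ℝ :=
  1 / (b * m) ^ 2 * Real.log (1 + 1 / (n * (1 / (b * m) ^ 2)))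

theorem biasTerm_nonneg {b n m : ℝ} (hn : 0 < n) : 0 ≤ biasTerm b n m := by
  have : 0 ≤ 1 / (n * (1 / (b * m) ^ 2)) := by positivity
  exact mul_nonneg (by positivity) (Real.log_nonneg (by linarith))

/-- The bound decays in `n` but only like `1 / k`, so it can be summed over `k ≤ n` only. -/
theorem sum_biasTerm_le {b n k : ℝ} (hb : 0 < b) (hn : 0 < n) (hk : 0 < k) (N : ℕ) :
    ∑ l ∈ Finset.range N, biasTerm b n (k * (l + 1)) ≤ 32 / b / (k * Real.sqrt n) := by
  have hsn : 0 < Real.sqrt n := Real.sqrt_pos.2 hn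
  have h := sum_one_div_sqrt_cube_le one_pos (show 0 < b * k / Real.sqrt n by positivity) N
  calc ∑ l ∈ Finset.range N, biasTerm b n (k * (l + 1))
      ≤ ∑ l ∈ Finset.range N,
          16 / n * (1 / Real.sqrt (1 + b * k / Real.sqrt n * (l + 1)) ^ 3) := by
        refine Finset.sum_le_sum fun l _ => ?_
        refine (mul_log_one_add_le hn (by positivity)).trans_eq ?_
        rw [show b * (k * ((l : ℝ) + 1)) / Real.sqrt n = b * k / Real.sqrt n * (l + 1) by ring]
    _ ≤ 16 / n * (2 / (b * k / Real.sqrt n * Real.sqrt 1)) := by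
        rw [← Finset.mul_sum]
        gcongr
    _ = 32 / b / (k * Real.sqrt n) := by
        rw [Real.sqrt_one, mul_one]
        nth_rewrite 1 [← Real.sq_sqrt hn.le]
        field_simp
        norm_num

/-- The complementary bound for `k > n`: the term decreases in `n`, so `n` is replaced by 1 and the
decay `k^(-3/2)` is summable. -/
theorem sum_biasTerm_le' {b n k : ℝ} (hb : 0 < b) (hn : 1 ≤ n) (hk : 0 < k) (N : ℕ) :
    ∑ l ∈ Finset.range N, biasTerm b n (k * (l + 1)) ≤
      96 / Real.sqrt b ^ 3 * (1 / Real.sqrt k ^ 3) := by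
  have hsb : 0 < Real.sqrt b := Real.sqrt_pos.2 hb
  have hsk : 0 < Real.sqrt k := Real.sqrt_pos.2 hk
  -- The telescoping bound needs a positive offset: `l + 1 ≥ 1/4 + 3/4 (l + 1)`, and the sum is at
  -- most `2 / (3/4 * 1/2) = 16/3 ≤ 6`.
  have h := sum_one_div_sqrt_cube_le (show (0 : ℝ) < 1 / 4 by norm_num)
    (show (0 : ℝ) < 3 / 4 by norm_num) N
  have h4 : Real.sqrt (1 / 4) = 1 / 2 := by
    rw [show (1 / 4 : ℝ) = (1 / 2) ^ 2 by norm_num]; exact Real.sqrt_sq (by norm_num)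
  rw [h4] at h
  calc ∑ l ∈ Finset.range N, biasTerm b n (k * (l + 1))
      ≤ ∑ l ∈ Finset.range N, 16 / (Real.sqrt b ^ 3 * Real.sqrt k ^ 3) *
          (1 / Real.sqrt (1 / 4 + 3 / 4 * (l + 1)) ^ 3) := by
        refine Finset.sum_le_sum fun l _ => ?_
        have hm : 0 < b * (k * ((l : ℝ) + 1)) := by positivity
        have h1 : biasTerm b n (k * (l + 1)) ≤ biasTerm b 1 (k * (l + 1)) := by
          unfold biasTerm
          gcongr
        refine h1.trans ((mul_log_one_add_le one_pos hm).trans ?_)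
        have hsl : 0 < Real.sqrt ((l : ℝ) + 1) := Real.sqrt_pos.2 (by positivity)
        have e1 : Real.sqrt b * (Real.sqrt k * Real.sqrt ((l : ℝ) + 1)) ≤
            Real.sqrt (1 + b * (k * ((l : ℝ) + 1)) / Real.sqrt 1) := by
          rw [← Real.sqrt_mul hk.le, ← Real.sqrt_mul hb.le]
          apply Real.sqrt_le_sqrt
          rw [Real.sqrt_one, div_one]
          linarith
        have e2 : Real.sqrt (1 / 4 + 3 / 4 * ((l : ℝ) + 1)) ≤ Real.sqrt ((l : ℝ) + 1) :=
          Real.sqrt_le_sqrt (by linarith [(Nat.cast_nonneg l : (0 : ℝ) ≤ l)])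
        have e3 : 0 < Real.sqrt (1 / 4 + 3 / 4 * ((l : ℝ) + 1)) := Real.sqrt_pos.2 (by positivity)
        calc 16 / 1 * (1 / Real.sqrt (1 + b * (k * ((l : ℝ) + 1)) / Real.sqrt 1) ^ 3)
            ≤ 16 / 1 * (1 / (Real.sqrt b * (Real.sqrt k * Real.sqrt ((l : ℝ) + 1))) ^ 3) := by gcongr
          _ = 16 / (Real.sqrt b ^ 3 * Real.sqrt k ^ 3) * (1 / Real.sqrt ((l : ℝ) + 1) ^ 3) := by
            field_simp
          _ ≤ _ := by gcongr
    _ ≤ 16 / (Real.sqrt b ^ 3 * Real.sqrt k ^ 3) * 6 := by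
        rw [← Finset.mul_sum]
        gcongr
        refine h.trans (by norm_num)
    _ = _ := by field_simp; norm_num

/-- The outer sum is split at `k = n`. The head is a harmonic sum and produces `log n`; the tail of
`k^(-3/2)` beyond `n` is at most `2 / √n`. -/
theorem sum_sum_biasTerm_le {b : ℝ} (hb : 0 < b) {n : ℕ} (hn : 1 ≤ n) (N : ℕ) :
    ∑ k ∈ Finset.range N, ∑ l ∈ Finset.range N, biasTerm b n ((k + 1) * (l + 1)) ≤
      (32 / b * (1 + Real.log n) + 192 / Real.sqrt b ^ 3) / Real.sqrt n := by
  have hn1 : (1 : ℝ) ≤ n := by exact_mod_cast hn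
  have hn0 : (0 : ℝ) < n := by linarith
  have hsn : 0 < Real.sqrt n := Real.sqrt_pos.2 hn0
  have hinner : ∀ k : ℕ, 0 ≤ ∑ l ∈ Finset.range N, biasTerm b n (((k : ℝ) + 1) * (l + 1)) :=
    fun k => Finset.sum_nonneg fun l _ => biasTerm_nonneg hn0
  -- The outer range is enlarged so that the split at `n` makes sense for every `N`.
  have hsub : ∑ k ∈ Finset.range N, ∑ l ∈ Finset.range N, biasTerm b n (((k : ℝ) + 1) * (l + 1)) ≤
      ∑ k ∈ Finset.range (n + N),
        ∑ l ∈ Finset.range N, biasTerm b n (((k : ℝ) + 1) * (l + 1)) :=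
    Finset.sum_le_sum_of_subset_of_nonneg (Finset.range_mono (by omega)) fun k _ _ => hinner k
  refine hsub.trans ?_
  rw [Finset.sum_range_add, add_div]
  refine add_le_add ?_ ?_
  · calc ∑ k ∈ Finset.range n, ∑ l ∈ Finset.range N, biasTerm b n (((k : ℝ) + 1) * (l + 1))
        ≤ ∑ k ∈ Finset.range n, 32 / b / Real.sqrt n * ((k : ℝ) + 1)⁻¹ := by
          refine Finset.sum_le_sum fun k _ =>
            (sum_biasTerm_le hb hn0 (by positivity) N).trans_eq ?_
          field_simp
      _ = 32 / b / Real.sqrt n * (harmonic n : ℝ) := by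
          rw [← Finset.mul_sum, harmonic]
          push_cast
          rfl
      _ ≤ 32 / b / Real.sqrt n * (1 + Real.log n) := by
          gcongr
          exact harmonic_le_one_add_log n
      _ = _ := by ring
  · have h := sum_one_div_sqrt_cube_le hn0 one_pos N
    calc ∑ k ∈ Finset.range N,
          ∑ l ∈ Finset.range N, biasTerm b n (((n + k : ℕ) + 1 : ℝ) * (l + 1))
        ≤ ∑ k ∈ Finset.range N,
            96 / Real.sqrt b ^ 3 * (1 / Real.sqrt (n + 1 * ((k : ℝ) + 1)) ^ 3) := by
          refine Finset.sum_le_sum fun k _ =>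
            (sum_biasTerm_le' hb hn1 (by positivity) N).trans_eq ?_
          push_cast
          rw [one_mul, add_assoc]
      _ ≤ 96 / Real.sqrt b ^ 3 * (2 / (1 * Real.sqrt n)) := by
          rw [← Finset.mul_sum]
          gcongr
      _ = _ := by field_simp; norm_num

/-- The bias series of a law on a set of positive integers with masses at most `1 / (b k) ^ 2`. -/
theorem bias_series_le {𝒳 : Set ℕ} (h𝒳 : ∀ k ∈ 𝒳, 1 ≤ k) {b : ℝ} (hb : 0 < b) {n : ℕ} (hn : 1 ≤ n)
    {q : 𝒳 → ℝ} (hpos : ∀ k, 0 < q k) (hq : ∀ k, q k ≤ 1 / (b * (k : ℕ)) ^ 2) :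
    (Summable fun k => q k * Real.log (1 + 1 / (n * q k))) ∧
      ∑' k, q k * Real.log (1 + 1 / (n * q k)) ≤ 32 / b / Real.sqrt n := by
  classical
  have hn0 : (0 : ℝ) < n := by exact_mod_cast hn
  have h0 : ∀ k, 0 ≤ q k * Real.log (1 + 1 / (n * q k)) := fun k => by
    have := hpos k
    have : 0 ≤ 1 / (n * q k) := by positivity
    exact mul_nonneg (hpos k).le (Real.log_nonneg (by linarith))
  have hfin : ∀ F : Finset 𝒳, ∑ k ∈ F, q k * Real.log (1 + 1 / (n * q k)) ≤
      32 / b / Real.sqrt n := by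
    intro F
    -- The shift by one matches letters, which start at 1, with `Finset.range`; truncated
    -- subtraction is injective here for that reason.
    have hinj : Set.InjOn (fun k : 𝒳 => (k : ℕ) - 1) F := fun k _ l _ h => by
      have := h𝒳 k k.2
      have := h𝒳 l l.2
      exact Subtype.ext (by simp only at h; omega)
    obtain ⟨N, hN⟩ := (F.image fun k : 𝒳 => (k : ℕ) - 1).exists_nat_subset_range
    calc ∑ k ∈ F, q k * Real.log (1 + 1 / (n * q k))
        ≤ ∑ k ∈ F, biasTerm b n (1 * (((k : ℕ) - 1 : ℕ) + 1)) := by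
          refine Finset.sum_le_sum fun k _ => ?_
          rw [show (1 : ℝ) * (((k : ℕ) - 1 : ℕ) + 1) = (k : ℕ) by
            rw [one_mul]; exact_mod_cast Nat.sub_add_cancel (h𝒳 k k.2)]
          exact mul_log_one_add_mono hn0 (hpos k) (hq k)
      _ = ∑ l ∈ F.image fun k : 𝒳 => (k : ℕ) - 1, biasTerm b n (1 * ((l : ℝ) + 1)) := by
          rw [Finset.sum_image hinj]
      _ ≤ ∑ l ∈ Finset.range N, biasTerm b n (1 * ((l : ℝ) + 1)) :=
          Finset.sum_le_sum_of_subset_of_nonneg hN fun _ _ _ => biasTerm_nonneg hn0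
      _ ≤ 32 / b / (1 * Real.sqrt n) := sum_biasTerm_le hb hn0 one_pos N
      _ = _ := by rw [one_mul]
  exact ⟨summable_of_sum_le h0 hfin, Real.tsum_le_of_sum_le h0 hfin⟩

/-- The bias series of a law on pairs of positive integers with masses at most
`1 / (b k l) ^ 2`. -/
theorem bias_series_pair_le {𝒳 : Set ℕ} (h𝒳 : ∀ k ∈ 𝒳, 1 ≤ k) {b : ℝ} (hb : 0 < b) {n : ℕ}
    (hn : 1 ≤ n) {q : 𝒳 × 𝒳 → ℝ} (hpos : ∀ a, 0 < q a)
    (hq : ∀ a, q a ≤ 1 / (b * ((a.1 : ℕ) * (a.2 : ℕ))) ^ 2) :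
    (Summable fun a => q a * Real.log (1 + 1 / (n * q a))) ∧
      ∑' a, q a * Real.log (1 + 1 / (n * q a)) ≤
        (32 / b * (1 + Real.log n) + 192 / Real.sqrt b ^ 3) / Real.sqrt n := by
  classical
  have hn0 : (0 : ℝ) < n := by exact_mod_cast hn
  have h0 : ∀ a, 0 ≤ q a * Real.log (1 + 1 / (n * q a)) := fun a => by
    have := hpos a
    have : 0 ≤ 1 / (n * q a) := by positivity
    exact mul_nonneg (hpos a).le (Real.log_nonneg (by linarith))
  have hcast : ∀ k : 𝒳, ((((k : ℕ) - 1 : ℕ) : ℝ) + 1) = (k : ℕ) := fun k => by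
    exact_mod_cast Nat.sub_add_cancel (h𝒳 k k.2)
  let e : 𝒳 × 𝒳 → ℕ × ℕ := fun a => ((a.1 : ℕ) - 1, (a.2 : ℕ) - 1)
  have hfin : ∀ F : Finset (𝒳 × 𝒳), ∑ a ∈ F, q a * Real.log (1 + 1 / (n * q a)) ≤
      (32 / b * (1 + Real.log n) + 192 / Real.sqrt b ^ 3) / Real.sqrt n := by
    intro F
    have hinj : Set.InjOn e F := fun a _ a' _ h => by
      have h1 := h𝒳 a.1 a.1.2
      have h2 := h𝒳 a'.1 a'.1.2
      have h3 := h𝒳 a.2 a.2.2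
      have h4 := h𝒳 a'.2 a'.2.2
      simp only [e, Prod.mk.injEq] at h
      exact Prod.ext (Subtype.ext (by omega)) (Subtype.ext (by omega))
    obtain ⟨N, hN⟩ : ∃ N, F.image e ⊆ Finset.range N ×ˢ Finset.range N := by
      obtain ⟨N₁, h₁⟩ := ((F.image e).image Prod.fst).exists_nat_subset_range
      obtain ⟨N₂, h₂⟩ := ((F.image e).image Prod.snd).exists_nat_subset_range
      refine ⟨max N₁ N₂, fun x hx => ?_⟩
      have a1 := Finset.mem_range.1 (h₁ (Finset.mem_image_of_mem Prod.fst hx))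
      have a2 := Finset.mem_range.1 (h₂ (Finset.mem_image_of_mem Prod.snd hx))
      simp only [Finset.mem_product, Finset.mem_range]
      omega
    calc ∑ a ∈ F, q a * Real.log (1 + 1 / (n * q a))
        ≤ ∑ a ∈ F, biasTerm b n (((e a).1 + 1) * ((e a).2 + 1)) := by
          refine Finset.sum_le_sum fun a _ => ?_
          rw [hcast, hcast]
          exact mul_log_one_add_mono hn0 (hpos a) (hq a)
      _ = ∑ x ∈ F.image e, biasTerm b n (((x.1 : ℝ) + 1) * (x.2 + 1)) := by
          rw [Finset.sum_image hinj]
      _ ≤ ∑ x ∈ Finset.range N ×ˢ Finset.range N, biasTerm b n (((x.1 : ℝ) + 1) * (x.2 + 1)) :=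
          Finset.sum_le_sum_of_subset_of_nonneg hN fun _ _ _ => biasTerm_nonneg hn0
      _ = ∑ k ∈ Finset.range N, ∑ l ∈ Finset.range N, biasTerm b n (((k : ℝ) + 1) * (l + 1)) :=
          Finset.sum_product _ _ _
      _ ≤ _ := sum_sum_biasTerm_le hb hn N
  exact ⟨summable_of_sum_le h0 hfin, Real.tsum_le_of_sum_le h0 hfin⟩

/-! ### Edge exchange and uniqueness of the maximum-weight spanning tree -/

section

variable {V : Type*}

/-- Exchanging an edge `u u'` of a tree for an edge that reconnects the two components left by
its removal gives a tree. -/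
theorem isTree_deleteEdges_sup_edge {G : SimpleGraph V} (hG : G.IsTree) {u u' a b : V}
    (ha : (G.deleteEdges {s(u, u')}).Reachable u a)
    (hb : ¬ (G.deleteEdges {s(u, u')}).Reachable u b) :
    (G.deleteEdges {s(u, u')} ⊔ SimpleGraph.edge a b).IsTree := by
  set D := G.deleteEdges {s(u, u')} with hD
  have hab : a ≠ b := fun h => hb (h ▸ ha)
  -- Induction along a walk of `G` from `u`: a step other than `u u'` stays in its component, and
  -- crossing `u u'` lands on one of its end points.
  have hsplit : ∀ x, D.Reachable u x ∨ D.Reachable u' x := by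
    intro x
    have hx := (SimpleGraph.reachable_iff_reflTransGen u x).1 (hG.connected u x)
    induction hx with
    | refl => exact Or.inl (SimpleGraph.Reachable.refl u)
    | @tail y z _ hyz ih =>
      by_cases he : s(y, z) = s(u, u')
      · rcases Sym2.eq_iff.1 he with ⟨_, rfl⟩ | ⟨_, rfl⟩
        · exact Or.inr (SimpleGraph.Reachable.refl _)
        · exact Or.inl (SimpleGraph.Reachable.refl _)
      · have hadj : D.Adj y z := by
          rw [hD, SimpleGraph.deleteEdges_adj]
          exact ⟨hyz, he⟩
        exact ih.imp (fun h => h.trans hadj.reachable) fun h => h.trans hadj.reachable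
  have hub : D.Reachable u' b := (hsplit b).resolve_left hb
  have hadj : (D ⊔ SimpleGraph.edge a b).Adj a b := by
    rw [SimpleGraph.sup_adj, SimpleGraph.edge_adj]
    exact Or.inr ⟨Or.inl ⟨rfl, rfl⟩, hab⟩
  have hle : D ≤ D ⊔ SimpleGraph.edge a b := le_sup_left
  have hu' : (D ⊔ SimpleGraph.edge a b).Reachable u u' :=
    (ha.mono hle).trans (hadj.reachable.trans (hub.mono hle).symm)
  have hall : ∀ x, (D ⊔ SimpleGraph.edge a b).Reachable u x := fun x =>
    (hsplit x).elim (fun h => h.mono hle) fun h => hu'.trans (h.mono hle)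
  have : Nonempty V := ⟨u⟩
  exact ⟨⟨fun x y => (hall x).symm.trans (hall y)⟩,
    (hG.isAcyclic.anti (SimpleGraph.deleteEdges_le _)).sup_edge_of_not_reachable
      fun h => hb (ha.trans h)⟩

/-- A tree is a minimal connected graph, so it cannot properly contain another tree on the same
vertices. -/
theorem exists_adj_not_adj_of_isTree_of_ne {G H : SimpleGraph V} (hG : G.IsTree) (hH : H.IsTree)
    (hne : H ≠ G) : ∃ u v, H.Adj u v ∧ ¬ G.Adj u v := by
  by_contra! h
  have hle : H ≤ G := fun u v huv => h u v huv
  exact hne (le_antisymm hle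
    ((SimpleGraph.isTree_iff_minimal_connected.1 hG).2 hH.connected hle))

end

section

variable {p : ℕ} {w : Fin p → Fin p → ℝ}

open scoped Classical in
theorem totalWeight_eq_sum_edgeSet (hw : ∀ i j, w i j = w j i) (T : SimpleGraph (Fin p)) :
    totalWeight w T = ∑ e ∈ Finset.univ.filter (· ∈ T.edgeSet), Sym2.lift ⟨w, hw⟩ e := by
  unfold totalWeight edgePairs
  refine Finset.sum_bij (fun e _ => s(e.1, e.2)) ?_ ?_ ?_ ?_
  · intro e he
    simpa using (Finset.mem_filter.1 he).2.2
  · intro e he f hf h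
    have h1 := (Finset.mem_filter.1 he).2.1
    have h2 := (Finset.mem_filter.1 hf).2.1
    rcases Sym2.eq_iff.1 h with ⟨h3, h4⟩ | ⟨h3, h4⟩
    · exact Prod.ext h3 h4
    · rw [h3, h4] at h1
      exact absurd h1 h2.asymm
  · intro e he
    induction e with
    | h i j =>
      have hadj : T.Adj i j := by simpa using he
      rcases lt_or_gt_of_ne hadj.ne with h | h
      · exact ⟨(i, j), by simp [h, hadj], rfl⟩
      · exact ⟨(j, i), by simp [h, hadj.symm], Sym2.eq_swap⟩
  · intro e _
    rfl

theorem totalWeight_deleteEdges_sup_edge (hw : ∀ i j, w i j = w j i) {G : SimpleGraph (Fin p)}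
    {u u' a b : Fin p} (hu : G.Adj u u') (hab : a ≠ b)
    (hn : ¬ (G.deleteEdges {s(u, u')}).Adj a b) :
    totalWeight w (G.deleteEdges {s(u, u')} ⊔ SimpleGraph.edge a b) =
      totalWeight w G - w u u' + w a b := by
  classical
  rw [totalWeight_eq_sum_edgeSet hw, totalWeight_eq_sum_edgeSet hw, Finset.sum_congr
    (s₂ := insert s(a, b) ((Finset.univ.filter (· ∈ G.edgeSet)).erase s(u, u'))) ?_
    (fun _ _ => rfl), Finset.sum_insert]
  · have := Finset.add_sum_erase (Finset.univ.filter (· ∈ G.edgeSet)) (Sym2.lift ⟨w, hw⟩)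
      (show s(u, u') ∈ _ by simpa using hu)
    simp only [Sym2.lift_mk] at this ⊢
    linarith
  · intro h
    apply hn
    rw [SimpleGraph.deleteEdges_adj]
    simp only [Finset.mem_erase, Finset.mem_filter, Finset.mem_univ, true_and] at h
    exact ⟨h.2, h.1⟩
  · ext e
    simp only [Finset.mem_filter, Finset.mem_univ, true_and, SimpleGraph.edgeSet_sup,
      SimpleGraph.edgeSet_deleteEdges, SimpleGraph.edgeSet_edge, Finset.mem_insert,
      Finset.mem_erase, Set.mem_union, Set.mem_sdiff, Set.mem_singleton_iff]
    constructor
    · rintro (h | h)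
      · exact Or.inr ⟨h.2, h.1⟩
      · exact Or.inl h.1
    · rintro (rfl | h)
      · exact Or.inr ⟨rfl, by simpa using hab⟩
      · exact Or.inl ⟨h.2, h.1⟩

/-- A tree `T` is the only maximum-weight spanning tree if every edge of a `T`-path with at least
two edges is heavier than the pair of end points of the path. -/
theorem isMaxSpanningTree_iff_eq (hw : ∀ i j, w i j = w j i) {T : SimpleGraph (Fin p)}
    (hT : T.IsTree)
    (h : ∀ a b u u', T.Adj a b → ∀ q : T.Walk u u', q.IsPath → s(a, b) ∈ q.edges → 2 ≤ q.length →
      w u u' < w a b) (T' : SimpleGraph (Fin p)) :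
    IsMaxSpanningTree w T' ↔ T' = T := by
  have himp : ∀ T', IsMaxSpanningTree w T' → T' = T := by
    rintro T' ⟨hT', hmax⟩
    by_contra hne
    obtain ⟨u, u', hadj, hnadj⟩ := exists_adj_not_adj_of_isTree_of_ne hT hT' hne
    obtain ⟨q, hq⟩ := hT.connected.exists_isPath u u'
    -- Deleting `u u'` cuts `T'` in two. The `T`-path from `u` to `u'` crosses the cut along some
    -- `T`-edge, which is strictly heavier by `h`; exchanging the edges would increase the weight of
    -- `T'`.
    have hbr : ¬ (T'.deleteEdges {s(u, u')}).Reachable u u' :=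
      SimpleGraph.isBridge_iff.1 (SimpleGraph.isAcyclic_iff_forall_adj_isBridge.1 hT'.isAcyclic hadj)
    obtain ⟨d, hd, ha, hb⟩ := q.exists_boundary_dart
      {x | (T'.deleteEdges {s(u, u')}).Reachable u x} (SimpleGraph.Reachable.refl u) hbr
    have ha' : (T'.deleteEdges {s(u, u')}).Reachable u d.fst := ha
    have hb' : ¬ (T'.deleteEdges {s(u, u')}).Reachable u d.snd := hb
    have hlen : 2 ≤ q.length := by
      by_contra! hlt
      interval_cases hl : q.length
      · exact hadj.ne (SimpleGraph.Walk.eq_of_length_eq_zero hl)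
      · exact hnadj (SimpleGraph.Walk.adj_of_length_eq_one hl)
    have hlt := h d.fst d.snd u u' d.adj q hq (List.mem_map.2 ⟨d, hd, rfl⟩) hlen
    have hle := hmax _ (isTree_deleteEdges_sup_edge hT' ha' hb')
    rw [totalWeight_deleteEdges_sup_edge hw hadj d.adj.ne
      fun hc => hb' (ha'.trans hc.reachable)] at hle
    linarith
  refine ⟨himp T', ?_⟩
  rintro rfl
  -- Some maximizer exists by finiteness, and the first half identifies it with `T`.
  obtain ⟨T₀, hT₀, hmax⟩ := Set.exists_max_image {G : SimpleGraph (Fin p) | G.IsTree}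
    (totalWeight w) (Set.toFinite _) ⟨T', hT⟩
  have : IsMaxSpanningTree w T₀ := ⟨hT₀, hmax⟩
  rwa [himp T₀ this] at this

end

/-! ### Bias of the plug-in information over the tree class -/

theorem toReal_map_apply {S A : Type*} [MeasurableSpace S] [DiscreteMeasurableSpace S]
    (P : PMF S) (f : S → A) (a : A) :
    (P.map f a).toReal = P.toMeasure.real (f ⁻¹' {a}) := by
  let _ : MeasurableSpace A := ⊤
  rw [Measure.real, ← PMF.toMeasure_apply_singleton (P.map f) a trivial,
    PMF.toMeasure_map_apply f P {a} Measurable.of_discrete trivial]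

theorem hasSum_toReal_map {S A : Type*} (P : PMF S) (f : S → A) :
    HasSum (fun a => (P.map f a).toReal) 1 := by
  have h := (P.map f).tsum_coe
  have h2 := ENNReal.hasSum_toReal (f := fun a => P.map f a) (by rw [h]; simp)
  rwa [← ENNReal.tsum_toReal_eq (fun a => (P.map f).apply_ne_top a), h, ENNReal.toReal_one] at h2

theorem mutualInfo_swap {α : Type*} (q : α → α → ℝ) (q₁ q₂ : α → ℝ) :
    mutualInfo (fun k l => q l k) q₂ q₁ = mutualInfo q q₁ q₂ := by
  unfold mutualInfo
  rw [← (Equiv.prodComm α α).tsum_eq]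
  simp [mul_comm]

theorem empPairInfo_comm {p n : ℕ} {α : Type*} (z : Fin n → Fin p → α) (i j : Fin p) :
    empPairInfo z i j = empPairInfo z j i := by
  unfold empPairInfo
  rw [← mutualInfo_swap]
  congr 1
  ext k l
  simp only [empPairMarginal]
  congr 3
  ext t
  simp [and_comm]

section

variable {p : ℕ} {𝒳 : Set ℕ}

theorem pairInfo_comm (P : PMF (Fin p → 𝒳)) (i j : Fin p) : pairInfo P i j = pairInfo P j i := by
  unfold pairInfo
  rw [← mutualInfo_swap]
  congr 1
  ext k l
  simp only [pairMarginal, toReal_map_apply]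
  congr 1
  ext x
  simp [and_comm]

/-- This is where `c ≥ 2` enters: for `m ≥ 1` the power law is dominated by the inverse square, with
scale `b = 1 / √K`. -/
theorem div_rpow_le_div_sq {c K m : ℝ} (hc : 2 ≤ c) (hK : 0 < K) (hm : 1 ≤ m) :
    K / m ^ c ≤ 1 / (1 / Real.sqrt K * m) ^ 2 := by
  have hm0 : 0 < m := by linarith
  rw [mul_pow, div_pow, Real.sq_sqrt hK.le, one_pow, one_div_mul_eq_div, one_div_div]
  gcongr
  rw [← Real.rpow_natCast]
  exact Real.rpow_le_rpow_of_exponent_le hm (by simpa using hc)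

namespace TreeClass

variable {T : SimpleGraph (Fin p)} {c c₁ c₂ : ℝ} {P : PMF (Fin p → 𝒳)}

theorem marginal_pos (h : TreeClass T c c₁ c₂ P) (h𝒳 : ∀ k ∈ 𝒳, 1 ≤ k) (hc₁ : 0 < c₁) (i : Fin p)
    (k : 𝒳) : 0 < marginal P i k := by
  have : (0 : ℝ) < (k : ℕ) := by exact_mod_cast h𝒳 k k.2
  exact lt_of_lt_of_le (by positivity) (h.marginal_bounds i k).1

theorem pairMarginal_pos (h : TreeClass T c c₁ c₂ P) (h𝒳 : ∀ k ∈ 𝒳, 1 ≤ k) (hc₁ : 0 < c₁)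
    {i j : Fin p} (hij : i ≠ j) (k l : 𝒳) : 0 < pairMarginal P i j k l := by
  have : (0 : ℝ) < (k : ℕ) := by exact_mod_cast h𝒳 k k.2
  have : (0 : ℝ) < (l : ℕ) := by exact_mod_cast h𝒳 l l.2
  exact lt_of_lt_of_le (by positivity) (h.pair_bounds i j hij k l).1

/-- The powers of `k` and `l` cancel between joint and product masses. The bound only secures
integrability of the sample mean and does not enter the final constant. -/
theorem abs_log_ratio_le (h : TreeClass T c c₁ c₂ P) (h𝒳 : ∀ k ∈ 𝒳, 1 ≤ k) (hc₁ : 0 < c₁)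
    (hc₂ : 0 < c₂) {i j : Fin p} (hij : i ≠ j) (k l : 𝒳) :
    |Real.log (pairMarginal P i j k l / (marginal P i k * marginal P j l))| ≤
      max |Real.log (c₁ / (c₂ * c₂))| |Real.log (c₂ / (c₁ * c₁))| := by
  have hk : (0 : ℝ) < (k : ℕ) := by exact_mod_cast h𝒳 k k.2
  have hl : (0 : ℝ) < (l : ℕ) := by exact_mod_cast h𝒳 l l.2
  have hkc := Real.rpow_pos_of_pos hk c
  have hlc := Real.rpow_pos_of_pos hl c
  have h1 := h.marginal_bounds i k
  have h2 := h.marginal_bounds j l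
  have h3 := h.pair_bounds i j hij k l
  have p1 := h.marginal_pos h𝒳 hc₁ i k
  have p2 := h.marginal_pos h𝒳 hc₁ j l
  have p3 := h.pairMarginal_pos h𝒳 hc₁ hij k l
  rw [Real.mul_rpow hk.le hl.le] at h3
  refine abs_le_max_abs_abs (Real.log_le_log (by positivity) ?_)
    (Real.log_le_log (by positivity) ?_)
  · calc c₁ / (c₂ * c₂) = c₁ / (((k : ℕ) : ℝ) ^ c * ((l : ℕ) : ℝ) ^ c) /
          (c₂ / ((k : ℕ) : ℝ) ^ c * (c₂ / ((l : ℕ) : ℝ) ^ c)) := by field_simp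
      _ ≤ _ := div_le_div₀ p3.le h3.1 (by positivity)
          (mul_le_mul h1.2 h2.2 p2.le (by positivity))
  · calc _ ≤ c₂ / (((k : ℕ) : ℝ) ^ c * ((l : ℕ) : ℝ) ^ c) /
          (c₁ / ((k : ℕ) : ℝ) ^ c * (c₁ / ((l : ℕ) : ℝ) ^ c)) :=
        div_le_div₀ (by positivity) h3.2 (by positivity)
          (mul_le_mul h1.1 h2.1 (by positivity) p1.le)
      _ = _ := by field_simp

end TreeClass

/-- Insert the true masses into the logarithm: the middle sum is an unbiased estimate of the
information, so the whole bias sits in the three divergences. -/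
theorem empPairInfo_mul_log_two_eq {P : PMF (Fin p → 𝒳)} {i j : Fin p}
    (hi : ∀ k, 0 < marginal P i k) (hj : ∀ k, 0 < marginal P j k)
    (hij : ∀ k l, 0 < pairMarginal P i j k l) {n : ℕ} (z : Fin n → Fin p → 𝒳) :
    empPairInfo z i j * Real.log 2 =
      empDiv (fun a : 𝒳 × 𝒳 => pairMarginal P i j a.1 a.2) (fun t => (z t i, z t j)) +
      (∑ t, Real.log (pairMarginal P i j (z t i) (z t j) /
        (marginal P i (z t i) * marginal P j (z t j)))) / n -
      empDiv (marginal P i) (fun t => z t i) - empDiv (marginal P j) (fun t => z t j) := by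
  have h2 : Real.log 2 ≠ 0 := (Real.log_pos one_lt_two).ne'
  rw [empPairInfo_eq_sum, div_mul_eq_mul_div, Finset.sum_mul]
  unfold empDiv
  rw [← add_div, ← sub_div, ← sub_div, ← Finset.sum_add_distrib, ← Finset.sum_sub_distrib,
    ← Finset.sum_sub_distrib]
  congr 1
  refine Finset.sum_congr rfl fun t _ => ?_
  have a1 := freq_self_pos (fun t => (z t i, z t j)) t
  have a2 := freq_self_pos (fun t => z t i) t
  have a3 := freq_self_pos (fun t => z t j) t
  have b1 := hij (z t i) (z t j)
  have b2 := hi (z t i)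
  have b3 := hj (z t j)
  rw [Real.logb, div_mul_cancel₀ _ h2, Real.log_div a1.ne' (mul_pos a2 a3).ne',
    Real.log_mul a2.ne' a3.ne', Real.log_div a1.ne' b1.ne', Real.log_div b1.ne' (mul_pos b2 b3).ne',
    Real.log_mul b2.ne' b3.ne', Real.log_div a2.ne' b2.ne', Real.log_div a3.ne' b3.ne']
  ring

theorem pairInfo_mul_log_two (P : PMF (Fin p → 𝒳)) (i j : Fin p) :
    pairInfo P i j * Real.log 2 = ∑' a : 𝒳 × 𝒳, pairMarginal P i j a.1 a.2 *
      Real.log (pairMarginal P i j a.1 a.2 / (marginal P i a.1 * marginal P j a.2)) := by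
  have h2 : Real.log 2 ≠ 0 := (Real.log_pos one_lt_two).ne'
  rw [pairInfo, mutualInfo, ← tsum_mul_right]
  refine tsum_congr fun a => ?_
  rw [Real.logb, mul_assoc, div_mul_cancel₀ _ h2]

/-- The constant in the bound on the bias of the plug-in estimate of the mutual information of a law
with masses at most `1 / (b k) ^ 2` and `1 / (b k l) ^ 2`. -/
noncomputable def biasConst (b : ℝ) : ℝ :=
  (160 / b + 192 / Real.sqrt b ^ 3) * 2 / Real.log 2

theorem biasConst_pos {b : ℝ} (hb : 0 < b) : 0 < biasConst b := by
  have := Real.log_pos one_lt_two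
  have := Real.sqrt_pos.2 hb
  unfold biasConst
  positivity

theorem integral_add_sub_sub {Ω : Type*} [MeasurableSpace Ω] {μ : Measure Ω} {f g u v : Ω → ℝ}
    (hf : Integrable f μ) (hg : Integrable g μ) (hu : Integrable u μ) (hv : Integrable v μ) :
    ∫ x, (f x + g x - u x - v x) ∂μ =
      ∫ x, f x ∂μ + ∫ x, g x ∂μ - ∫ x, u x ∂μ - ∫ x, v x ∂μ := by
  have hfg : Integrable (fun x => f x + g x) μ := hf.add hg
  have hfgu : Integrable (fun x => f x + g x - u x) μ := hfg.sub hu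
  rw [integral_sub hfgu hv, integral_sub hfg hu, integral_add hf hg]

/-- The bias of the plug-in estimate of the mutual information. -/
theorem TreeClass.abs_integral_empPairInfo_sub_le {T : SimpleGraph (Fin p)} {c c₁ c₂ : ℝ}
    {P : PMF (Fin p → 𝒳)} (h : TreeClass T c c₁ c₂ P) (hc : 2 ≤ c) (hc₁ : 0 < c₁) (hc₂ : 0 < c₂)
    (h𝒳 : ∀ k ∈ 𝒳, 1 ≤ k) {i j : Fin p} (hij : i ≠ j) {n : ℕ} (hn : 2 ≤ n) :
    |∫ z : Fin n → Fin p → 𝒳, empPairInfo z i j ∂Measure.pi (fun _ => P.toMeasure) -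
      pairInfo P i j| ≤ biasConst (1 / Real.sqrt c₂) * (Real.log n / Real.sqrt n) := by
  have hn0 : 0 < n := by omega
  have hnR : (0 : ℝ) < n := by exact_mod_cast hn0
  have hsn : 0 < Real.sqrt n := Real.sqrt_pos.2 hnR
  have hl2 : 0 < Real.log 2 := Real.log_pos one_lt_two
  have hb : 0 < 1 / Real.sqrt c₂ := by
    have := Real.sqrt_pos.2 hc₂
    positivity
  set b := 1 / Real.sqrt c₂ with hbdef
  have hcast : ∀ k : 𝒳, (1 : ℝ) ≤ (k : ℕ) := fun k => by exact_mod_cast h𝒳 k k.2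
  have single : ∀ i, Integrable (fun z : Fin n → Fin p → 𝒳 => empDiv (marginal P i) fun t => z t i)
        (Measure.pi fun _ => P.toMeasure) ∧
      ∫ z : Fin n → Fin p → 𝒳, empDiv (marginal P i) (fun t => z t i)
        ∂Measure.pi (fun _ => P.toMeasure) ≤ 32 / b / Real.sqrt n := by
    intro i
    have hs := bias_series_le h𝒳 hb (show 1 ≤ n by omega) (h.marginal_pos h𝒳 hc₁ i)
      fun k => (h.marginal_bounds i k).2.trans (div_rpow_le_div_sq hc hc₂ (hcast k))
    have hd := integral_empDiv_le (ν := P.toMeasure) hn0 (fun x : Fin p → 𝒳 => x i)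
      (q := marginal P i) (fun a => toReal_map_apply P _ a) (hasSum_toReal_map P _)
      (h.marginal_pos h𝒳 hc₁ i) hs.1
    exact ⟨hd.1, hd.2.trans hs.2⟩
  obtain ⟨ii, bi⟩ := single i
  obtain ⟨ij, bj⟩ := single j
  obtain ⟨iij, bij⟩ : Integrable (fun z : Fin n → Fin p → 𝒳 =>
        empDiv (fun a : 𝒳 × 𝒳 => pairMarginal P i j a.1 a.2) fun t => (z t i, z t j))
        (Measure.pi fun _ => P.toMeasure) ∧
      ∫ z : Fin n → Fin p → 𝒳,
        empDiv (fun a : 𝒳 × 𝒳 => pairMarginal P i j a.1 a.2) (fun t => (z t i, z t j))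
        ∂Measure.pi (fun _ => P.toMeasure) ≤
        (32 / b * (1 + Real.log n) + 192 / Real.sqrt b ^ 3) / Real.sqrt n := by
    have hs := bias_series_pair_le h𝒳 hb (show 1 ≤ n by omega)
      (q := fun a => pairMarginal P i j a.1 a.2)
      (fun a => h.pairMarginal_pos h𝒳 hc₁ hij a.1 a.2)
      fun a => (h.pair_bounds i j hij a.1 a.2).2.trans (div_rpow_le_div_sq hc hc₂
        (one_le_mul_of_one_le_of_one_le (hcast a.1) (hcast a.2)))
    have hd := integral_empDiv_le (ν := P.toMeasure) hn0 (fun x : Fin p → 𝒳 => (x i, x j))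
      (q := fun a => pairMarginal P i j a.1 a.2) (fun a => toReal_map_apply P _ a)
      (hasSum_toReal_map P _) (fun a => h.pairMarginal_pos h𝒳 hc₁ hij a.1 a.2) hs.1
    exact ⟨hd.1, hd.2.trans hs.2⟩
  have nonneg : ∀ i, 0 ≤ ∫ z : Fin n → Fin p → 𝒳, empDiv (marginal P i) (fun t => z t i)
      ∂Measure.pi (fun _ => P.toMeasure) := fun i => integral_nonneg fun z =>
    empDiv_nonneg hn0 (hasSum_toReal_map P _) (h.marginal_pos h𝒳 hc₁ i) _
  have nonneg2 : 0 ≤ ∫ z : Fin n → Fin p → 𝒳,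
      empDiv (fun a : 𝒳 × 𝒳 => pairMarginal P i j a.1 a.2) (fun t => (z t i, z t j))
      ∂Measure.pi (fun _ => P.toMeasure) := integral_nonneg fun z =>
    empDiv_nonneg hn0 (hasSum_toReal_map P fun x => (x i, x j))
      (fun a => h.pairMarginal_pos h𝒳 hc₁ hij a.1 a.2) _
  obtain ⟨ig, eg⟩ := integral_sum_comp_div (ν := P.toMeasure) hn0
    (fun x : Fin p → 𝒳 => (x i, x j)) (q := fun a => pairMarginal P i j a.1 a.2)
    (fun a => toReal_map_apply P _ a)
    (g := fun a => Real.log (pairMarginal P i j a.1 a.2 / (marginal P i a.1 * marginal P j a.2)))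
    (fun a => h.abs_log_ratio_le h𝒳 hc₁ hc₂ hij a.1 a.2)
  have hE : (∫ z : Fin n → Fin p → 𝒳, empPairInfo z i j ∂Measure.pi (fun _ => P.toMeasure)) *
      Real.log 2 = (∫ z : Fin n → Fin p → 𝒳,
        empDiv (fun a : 𝒳 × 𝒳 => pairMarginal P i j a.1 a.2) (fun t => (z t i, z t j))
        ∂Measure.pi (fun _ => P.toMeasure)) + pairInfo P i j * Real.log 2 -
      (∫ z : Fin n → Fin p → 𝒳, empDiv (marginal P i) (fun t => z t i)
        ∂Measure.pi (fun _ => P.toMeasure)) -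
      ∫ z : Fin n → Fin p → 𝒳, empDiv (marginal P j) (fun t => z t j)
        ∂Measure.pi (fun _ => P.toMeasure) := by
    rw [← integral_mul_const, pairInfo_mul_log_two, ← eg,
      ← integral_add_sub_sub iij ig ii ij]
    exact integral_congr_ae (ae_of_all _ fun z => empPairInfo_mul_log_two_eq
      (h.marginal_pos h𝒳 hc₁ i) (h.marginal_pos h𝒳 hc₁ j) (h.pairMarginal_pos h𝒳 hc₁ hij) z)
  -- Lets additive constants be absorbed into `log n`; it accounts for the factor 2 in `biasConst`.
  have hlog : 1 ≤ 2 * Real.log n := by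
    have : Real.log 2 ≤ Real.log n := Real.log_le_log two_pos (by exact_mod_cast hn)
    linarith [Real.log_two_gt_d9]
  have hbound : (32 / b * (1 + Real.log n) + 192 / Real.sqrt b ^ 3) / Real.sqrt n +
      32 / b / Real.sqrt n + 32 / b / Real.sqrt n ≤
      biasConst b * (Real.log n / Real.sqrt n) * Real.log 2 := by
    have e1 : biasConst b * (Real.log n / Real.sqrt n) * Real.log 2 =
        (160 / b + 192 / Real.sqrt b ^ 3) * (2 * Real.log n) / Real.sqrt n := by
      unfold biasConst
      field_simp
    rw [e1, ← add_div, ← add_div]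
    gcongr
    have hsb : 0 ≤ 192 / Real.sqrt b ^ 3 := by positivity
    have hb' : 0 ≤ 32 / b := by positivity
    have : 160 / b = 5 * (32 / b) := by ring
    rw [this]
    nlinarith [mul_le_mul_of_nonneg_left hlog hsb, mul_le_mul_of_nonneg_left hlog hb']
  -- As all three divergences have nonnegative mean, the bias lies between minus the two marginal
  -- bounds and plus the joint one.
  have hni := nonneg i
  have hnj := nonneg j
  have h1 : 0 ≤ (32 / b * (1 + Real.log n) + 192 / Real.sqrt b ^ 3) / Real.sqrt n :=
    nonneg2.trans bij
  have h2 : 0 ≤ 32 / b / Real.sqrt n := by positivity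
  rw [← mul_le_mul_iff_of_pos_right hl2]
  nth_rewrite 1 [← abs_of_pos hl2]
  rw [← abs_mul, sub_mul, hE, abs_le]
  constructor <;> linarith

/-! ### Union bound and error probability -/

/-- The threshold bounds the gap between the information of an edge of a path of `T` and that of the
end points of the path. -/
theorem two_mul_infoThreshold_le {α : Type*} {T : SimpleGraph (Fin p)} (P : PMF (Fin p → α))
    {a b u u' : Fin p} (hab : T.Adj a b) (q : T.Walk u u') (hq : q.IsPath)
    (hmem : s(a, b) ∈ q.edges) (hlen : 2 ≤ q.length) :
    2 * infoThreshold T P ≤ pairInfo P a b - pairInfo P u u' := by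
  have h := ciInf_le (f := fun τ : feasibleSet T =>
      pairInfo P τ.1.1.1 τ.1.1.2 - pairInfo P τ.1.2.1 τ.1.2.2)
    (Set.finite_range _).bddBelow ⟨((a, b), (u, u')), hab, q, hq, hmem, hlen⟩
  simp only [infoThreshold]
  linarith

/-- The Chow-Liu algorithm is correct if all mutual informations are estimated with an error
below the information threshold. -/
theorem chowLiuOutputs_eq {T : SimpleGraph (Fin p)} (hT : T.IsTree) (P : PMF (Fin p → 𝒳)) {n : ℕ}
    (z : Fin n → Fin p → 𝒳)
    (hz : ∀ i j, i < j → |empPairInfo z i j - pairInfo P i j| < infoThreshold T P) :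
    chowLiuOutputs z = {T} := by
  have hz' : ∀ i j, i ≠ j → |empPairInfo z i j - pairInfo P i j| < infoThreshold T P := by
    intro i j hij
    rcases lt_or_gt_of_ne hij with h | h
    · exact hz i j h
    · rw [empPairInfo_comm, pairInfo_comm]
      exact hz j i h
  ext T'
  refine isMaxSpanningTree_iff_eq (empPairInfo_comm z) hT (fun a b u u' hab q hq hmem hlen => ?_) T'
  have hne : u ≠ u' := by
    rintro rfl
    have := (SimpleGraph.Walk.isPath_iff_nil.1 hq).length_eq_zero
    omega
  have h1 := abs_lt.1 (hz' a b hab.ne)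
  have h2 := abs_lt.1 (hz' u u' hne)
  have h3 := two_mul_infoThreshold_le P hab q hq hmem hlen
  linarith [h1.1, h2.2]

/-- The 2 on the left absorbs the factor from the two-sided tail bound in the union over pairs. -/
theorem two_mul_card_filter_lt_le (p : ℕ) :
    2 * ((Finset.univ : Finset (Fin p × Fin p)).filter fun e => e.1 < e.2).card ≤ p ^ 2 := by
  have h1 : ((Finset.univ : Finset (Fin p × Fin p)).filter fun e => e.1 < e.2).card =
      ((Finset.univ : Finset (Fin p × Fin p)).filter fun e => e.2 < e.1).card :=
    Finset.card_bij (fun e _ => e.swap) (by simp) (fun _ _ _ _ h => Prod.swap_injective h)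
      fun e he => ⟨e.swap, by simpa using he, by simp⟩
  have h2 : Disjoint ((Finset.univ : Finset (Fin p × Fin p)).filter fun e => e.1 < e.2)
      ((Finset.univ : Finset (Fin p × Fin p)).filter fun e => e.2 < e.1) :=
    Finset.disjoint_filter.2 fun e _ h => h.asymm
  rw [two_mul]
  nth_rewrite 2 [h1]
  rw [← Finset.card_union_of_disjoint h2]
  refine (Finset.card_le_univ _).trans_eq ?_
  simp [sq]

/-- The tail probability of one empirical mutual information at the sample size of the theorem. -/
theorem exp_neg_le_sq_div {p n : ℕ} (hp : 3 ≤ p) (hn : 2 ≤ n) {δ ε : ℝ} (hδ : 0 < δ) (hδ1 : δ < 1)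
    (hε : 0 < ε) (h : (n : ℝ) / Real.logb 2 n ^ 2 ≥ 72 * Real.log (p / δ) / ε ^ 2) :
    Real.exp (-(2 * ε ^ 2 / (n * (3 * (Real.log n + 1) / (n * Real.log 2)) ^ 2))) ≤
      (δ / p) ^ 2 := by
  have hpR : (3 : ℝ) ≤ p := by exact_mod_cast hp
  have hnR : (2 : ℝ) ≤ n := by exact_mod_cast hn
  have hn0 : (0 : ℝ) < n := by linarith
  have hl2 : 0 < Real.log 2 := Real.log_pos one_lt_two
  have hln : Real.log 2 ≤ Real.log n := Real.log_le_log two_pos hnR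
  have hln0 : 0 < Real.log n := hl2.trans_le hln
  set L := Real.log (p / δ) with hL
  have hpd : 0 < (p : ℝ) / δ := by positivity
  have hL0 : 0 ≤ L := Real.log_nonneg ((one_le_div hδ).2 (by linarith))
  have hexp : (δ / p) ^ 2 = Real.exp (-(2 * L)) := by
    rw [Real.exp_neg, mul_comm, ← Real.rpow_natCast, Real.exp_mul, hL, Real.exp_log hpd,
      ← Real.inv_rpow hpd.le, inv_div]
    norm_num
  rw [hexp]
  refine Real.exp_le_exp.2 (neg_le_neg ?_)
  have h1 : 72 * L * Real.log n ^ 2 ≤ n * Real.log 2 ^ 2 * ε ^ 2 := by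
    rw [ge_iff_le, Real.logb, div_pow, div_div_eq_mul_div, div_le_div_iff₀ (by positivity)
      (by positivity)] at h
    exact h
  -- Origin of the 72: the squared factor 3 of the bounded differences, and `(log n + 1)² ≤ 8 (log
  -- n)²`, valid because `log n ≥ log 2 > 2/3`.
  have h2 : 9 * (Real.log n + 1) ^ 2 ≤ 72 * Real.log n ^ 2 := by
    have : 2 / 3 ≤ Real.log n := by linarith [Real.log_two_gt_d9]
    nlinarith
  have h3 : 2 * ε ^ 2 / (n * (3 * (Real.log n + 1) / (n * Real.log 2)) ^ 2) =
      2 * (n * Real.log 2 ^ 2 * ε ^ 2) / (9 * (Real.log n + 1) ^ 2) := by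
    field_simp
    norm_num
  rw [h3, le_div_iff₀ (by positivity)]
  calc 2 * L * (9 * (Real.log n + 1) ^ 2) ≤ 2 * L * (72 * Real.log n ^ 2) := by gcongr
    _ = 2 * (72 * L * Real.log n ^ 2) := by ring
    _ ≤ _ := by gcongr

/-- The error probability of the Chow-Liu algorithm for a sample from the product measure. -/
theorem TreeClass.measure_chowLiuOutputs_ne_le {T : SimpleGraph (Fin p)} {c c₁ c₂ : ℝ}
    {P : PMF (Fin p → 𝒳)} (h : TreeClass T c c₁ c₂ P) (hc : 2 ≤ c) (hc₁ : 0 < c₁) (hc₂ : 0 < c₂)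
    (hp : 3 ≤ p) (h𝒳 : ∀ k ∈ 𝒳, 1 ≤ k) {n : ℕ} (hn : 2 ≤ n) {δ : ℝ} (hδ : 0 < δ) (hδ1 : δ < 1)
    {ε : ℝ} (hε : 0 < ε)
    (hεT : infoThreshold T P - biasConst (1 / Real.sqrt c₂) * (Real.log n / Real.sqrt n) = ε)
    (hlarge : (n : ℝ) / Real.logb 2 n ^ 2 ≥ 72 * Real.log (p / δ) / ε ^ 2) :
    (Measure.pi fun _ : Fin n => P.toMeasure).real {z | chowLiuOutputs z = {T}}ᶜ ≤ δ := by
  have hpR : (3 : ℝ) ≤ p := by exact_mod_cast hp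
  let E : Fin p × Fin p → Set (Fin n → Fin p → 𝒳) := fun e =>
    {z | ε ≤ |empPairInfo z e.1 e.2 -
      ∫ y : Fin n → Fin p → 𝒳, empPairInfo y e.1 e.2 ∂Measure.pi (fun _ => P.toMeasure)|}
  have hsub : {z : Fin n → Fin p → 𝒳 | chowLiuOutputs z = {T}}ᶜ ⊆
      ⋃ e ∈ (Finset.univ : Finset (Fin p × Fin p)).filter fun e => e.1 < e.2, E e := by
    intro z hz
    by_contra hcon
    refine hz (chowLiuOutputs_eq h.isTree P z fun i j hij => ?_)
    by_contra! hge
    refine hcon (Set.mem_biUnion (x := (i, j)) (by simpa using hij) ?_)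
    have hb := h.abs_integral_empPairInfo_sub_le hc hc₁ hc₂ h𝒳 hij.ne hn
    have := abs_sub_le (empPairInfo z i j) (∫ y : Fin n → Fin p → 𝒳, empPairInfo y i j
      ∂Measure.pi (fun _ => P.toMeasure)) (pairInfo P i j)
    change ε ≤ |_|
    linarith
  have hE : ∀ e, (Measure.pi fun _ : Fin n => P.toMeasure).real (E e) ≤ 2 * (δ / p) ^ 2 :=
    fun e => (measure_abs_sub_integral_ge_le P.toMeasure Measurable.of_discrete
      (fun z t s => abs_empPairInfo_update_sub_le z e.1 e.2 t s) hε.le).trans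
      (mul_le_mul_of_nonneg_left (exp_neg_le_sq_div hp hn hδ hδ1 hε hlarge) zero_le_two)
  calc (Measure.pi fun _ : Fin n => P.toMeasure).real {z | chowLiuOutputs z = {T}}ᶜ
      ≤ (Measure.pi fun _ : Fin n => P.toMeasure).real
          (⋃ e ∈ (Finset.univ : Finset (Fin p × Fin p)).filter fun e => e.1 < e.2, E e) :=
        measureReal_mono hsub (measure_ne_top _ _)
    _ ≤ ∑ e ∈ (Finset.univ : Finset (Fin p × Fin p)).filter fun e => e.1 < e.2,
          (Measure.pi fun _ : Fin n => P.toMeasure).real (E e) := measureReal_biUnion_finset_le _ _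
    _ ≤ ∑ _e ∈ (Finset.univ : Finset (Fin p × Fin p)).filter fun e => e.1 < e.2,
          2 * (δ / p) ^ 2 := Finset.sum_le_sum fun e _ => hE e
    _ = (2 * ((Finset.univ : Finset (Fin p × Fin p)).filter fun e => e.1 < e.2).card : ℕ) *
          (δ / p) ^ 2 := by
        rw [Finset.sum_const, nsmul_eq_mul]
        push_cast
        ring
    _ ≤ (p ^ 2 : ℕ) * (δ / p) ^ 2 := by
        gcongr
        exact two_mul_card_filter_lt_le p
    _ = δ ^ 2 := by
        push_cast
        field_simp
    _ ≤ δ := by nlinarith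

end

end ChowLiu

theorem theorem5 (c c₁ c₂ : ℝ) (hc : 2 ≤ c) (hc₁ : 0 < c₁) (hc₂ : 0 < c₂) :
    ∃ C : ℝ, 0 < C ∧
      ∀ (p : ℕ) (_ : 3 ≤ p) (𝒳 : Set ℕ) (_ : ∀ k ∈ 𝒳, 1 ≤ k)
        (T : SimpleGraph (Fin p)) (P : PMF (Fin p → 𝒳)) (_ : ChowLiu.TreeClass T c c₁ c₂ P)
        (δ : ℝ) (_ : 0 < δ) (_ : δ < 1) (n : ℕ) (_ : 2 ≤ n)
        (Ω : Type*) [MeasurableSpace Ω] (μ : MeasureTheory.Measure Ω)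
        [MeasureTheory.IsProbabilityMeasure μ] (X : Fin n → Ω → Fin p → 𝒳)
        (_ : ∀ t, ProbabilityTheory.HasLaw (X t) P.toMeasure μ)
        (_ : ProbabilityTheory.iIndepFun X μ)
        (_ : (n : ℝ) / Real.logb 2 n ^ 2 ≥
          72 * Real.log (p / δ) /
            (ChowLiu.infoThreshold T P - C * (Real.log n / Real.sqrt n)) ^ 2)
        (_ : ChowLiu.infoThreshold T P > C * (Real.log n / Real.sqrt n)),
        μ.real {ω | ChowLiu.chowLiuOutputs (fun t => X t ω) = {T}} ≥ 1 - δ := by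
  have hb : 0 < 1 / Real.sqrt c₂ := one_div_pos.2 (Real.sqrt_pos.2 hc₂)
  refine ⟨ChowLiu.biasConst (1 / Real.sqrt c₂), ChowLiu.biasConst_pos hb, ?_⟩
  intro p hp 𝒳 h𝒳 T P hP δ hδ hδ1 n hn Ω _ μ _ X hX hind hlarge hthr
  -- Independence and the common law give the sample the product law, to which the error bound
  -- applies.
  have hlaw := hind.hasLaw_pi hX
  have hbad := hP.measure_chowLiuOutputs_ne_le hc hc₁ hc₂ hp h𝒳 hn hδ hδ1
    (sub_pos.2 hthr) rfl hlarge
  rw [MeasureTheory.probReal_compl_eq_one_sub MeasurableSet.of_discrete] at hbad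
  have heq := hlaw.measureReal_eq (p := fun z => ChowLiu.chowLiuOutputs z = {T})
    MeasurableSet.of_discrete
  rw [heq]
  linarith
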